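/- Fix $c\in(0,1)$ and let $\lambda$ be Lebesgue measure on $[0,1]$. For a map that is $C^3$ with $DT\neq 0$ on an interval (derivatives at an end point belonging to the interval being one-sided), its Schwarzian derivative is $\mathbf ST=\frac{D^3T}{DT}-\frac32\big(\frac{D^2T}{DT}\big)^2$; it is called non-positive on the interval if the map is $C^3$ with $DT\ne0$ and $\mathbf ST\le 0$ there. A map $T:[0,1]\to[0,1]$ is *good* with exponent $r$ if: (G1) $T|_{(0,c)}$ and $T|_{(c,1)}$ are $C^3$ diffeomorphisms onto $(0,1)$, and $T(\{0,c,1\})\subseteq\{0,1\}$; (G2) $T$ has non-positive Schwarzian derivative on $[0,c)$ and on $(c,1]$; (G3) $r\ge1$ and there are $0<K<1$ and $M>r$ with $K|x-c|^{r-1}\le|DT(x)|\le M|x-c|^{r-1}$ for all $x\in[0,1]\setminus\{c\}$; (G4) $|DT(0)|,|DT(1)|>1$. A map $T:[0,1]\to[0,1]$ is *bad* with exponent $\ell$ if: (B1) each of $T|_{(0,c)}$ and $T|_{(c,1)}$ is a $C^3$ diffeomorphism onto $(0,c)$ or onto $(c,1)$, $T(\{0,1\})\subseteq\{0,1\}$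 and $T(c)=c$; (B2) $T$ has non-positive Schwarzian derivative on $[0,c)$ and on $(c,1]$; (B3) $\ell>1$ and there are $0<K<1$ and $M>\ell$ with $K|x-c|^{\ell-1}\le|DT(x)|\le M|x-c|^{\ell-1}$ for all $x\in[0,1]\setminus\{c\}$; (B4) $|DT(0)|,|DT(1)|>1$. Let $T_1,\dots,T_N$ be finitely many maps, each of which is good or bad, let $\Sigma_G$ and $\Sigma_B$ be the sets of the indices of the good and of the bad maps, and assume that both are non-empty. Let $r_g$ ($g\in\Sigma_G$) and $\ell_b$ ($b\in\Sigma_B$) be the exponents of these maps, and let $(p_j)_{1\le j\le N}$ be a probability vector with all $p_j>0$. For a finite Borel measure $\nu$ on $[0,1]$ put $\mathcal P\nu=\sum_{j=1}^N p_j\,\nu\circ T_j^{-1}$, and let $\lambda_n=\mathcal P^n\lambda$ for $n\ge0$. For a word $\mathbf b=b_1\cdots b_k\in\Sigma_B^k$ write $p_{\mathbf b}=\prod_{i=1}^k p_{b_i}$ and $\ell_{\mathbf b}=\prod_{i=1}^k\ell_{b_i}$, both being $1$ when $k=0$. **Theorem.** There exists a constant $C>0$ such that for all integers $n\ge0$ and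 all Borel sets $A\subseteq[0,1]$ $$\lambda_n(A)\le C\sum_{g\in\Sigma_G}p_g\sum_{k=0}^\infty\sum_{\mathbf b\in\Sigma_B^k}p_{\mathbf b}\,\ell_{\mathbf b}\,\lambda(A)^{\ell_{\mathbf b}^{-1}r_g^{-1}},$$ where the right-hand side is an element of $[0,\infty]$. -/

import Mathlib

open MeasureTheory Set

noncomputable section

namespace CriticalIntermittency

/-- A self-map of `[0,1]` regarded as a real function. It is constant to the left of `0` and to the
right of `1`; below only its behaviour on subsets of `[0,1]` is used. -/
def toReal (T : unitInterval → unitInterval) : ℝ → ℝ :=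
  fun x => (T (projIcc (0 : ℝ) 1 zero_le_one x) : ℝ)

/-- `f` restricts to a `C^3` diffeomorphism from the open set `U` onto the open set `V`. -/
def IsC3Diffeo (f : ℝ → ℝ) (U V : Set ℝ) : Prop :=
  ∃ h : ℝ → ℝ, MapsTo f U V ∧ MapsTo h V U ∧ InvOn h f U V ∧
    ContDiffOn ℝ 3 f U ∧ ContDiffOn ℝ 3 h V

/-- The Schwarzian derivative of `f` at `x`, with derivatives taken in the interval `J`
(hence one-sided at an end point that belongs to `J`). -/
def schwarzian (f : ℝ → ℝ) (J : Set ℝ) (x : ℝ) : ℝ :=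
  iteratedDerivWithin 3 f J x / derivWithin f J x
    - 3 / 2 * (iteratedDerivWithin 2 f J x / derivWithin f J x) ^ 2

/-- `f` is `C^3` on the interval `J`, without critical points there, and its Schwarzian derivative
is non-positive on `J`. -/
def NonposSchwarzian (f : ℝ → ℝ) (J : Set ℝ) : Prop :=
  ContDiffOn ℝ 3 f J ∧ ∀ x ∈ J, derivWithin f J x ≠ 0 ∧ schwarzian f J x ≤ 0

/-- On the interval `J`, `|Df(x)|` lies between `K |x - c|^(r-1)` and `M |x - c|^(r-1)`. -/
def DerivOrderBounds (f : ℝ → ℝ) (J : Set ℝ) (c r K M : ℝ) : Prop :=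
  ∀ x ∈ J, K * |x - c| ^ (r - 1) ≤ |derivWithin f J x| ∧
    |derivWithin f J x| ≤ M * |x - c| ^ (r - 1)

/-- The requirements shared by good and bad maps `f` with order `r` at `c`: non-positive Schwarzian
derivative on `[0,c)` and `(c,1]`, order of the derivative at `c` (the two bounds are for `x ≠ c`,
since a good map may jump at `c`), and repelling end points. -/
structure BranchConditions (c r : ℝ) (f : ℝ → ℝ) : Prop where
  schwarzian_left : NonposSchwarzian f (Ico 0 c)
  schwarzian_right : NonposSchwarzian f (Ioc c 1)
  order_bounds : ∃ K M : ℝ, 0 < K ∧ K < 1 ∧ r < M ∧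
    DerivOrderBounds f (Ico 0 c) c r K M ∧ DerivOrderBounds f (Ioc c 1) c r K M
  expanding_zero : 1 < |derivWithin f (Ico 0 c) 0|
  expanding_one : 1 < |derivWithin f (Ioc c 1) 1|

/-- `T` is a good map with critical point `c` and associated exponent `r`. -/
structure IsGoodMapOfOrder (c r : ℝ) (T : unitInterval → unitInterval) : Prop where
  one_le_order : 1 ≤ r
  diffeo_left : IsC3Diffeo (toReal T) (Ioo 0 c) (Ioo 0 1)
  diffeo_right : IsC3Diffeo (toReal T) (Ioo c 1) (Ioo 0 1)
  special_points : ∀ x ∈ ({0, c, 1} : Set ℝ), toReal T x ∈ ({0, 1} : Set ℝ)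
  branches : BranchConditions c r (toReal T)

/-- `T` is a bad map with superattracting fixed point `c` and associated exponent `r`. -/
structure IsBadMapOfOrder (c r : ℝ) (T : unitInterval → unitInterval) : Prop where
  one_lt_order : 1 < r
  diffeo_left : IsC3Diffeo (toReal T) (Ioo 0 c) (Ioo 0 c) ∨
    IsC3Diffeo (toReal T) (Ioo 0 c) (Ioo c 1)
  diffeo_right : IsC3Diffeo (toReal T) (Ioo c 1) (Ioo 0 c) ∨
    IsC3Diffeo (toReal T) (Ioo c 1) (Ioo c 1)
  end_points : ∀ x ∈ ({0, 1} : Set ℝ), toReal T x ∈ ({0, 1} : Set ℝ)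
  fixed : toReal T c = c
  branches : BranchConditions c r (toReal T)

/-- The class of good maps with critical point `c`. -/
def IsGoodMap (c : ℝ) (T : unitInterval → unitInterval) : Prop := ∃ r, IsGoodMapOfOrder c r T

/-- The class of bad maps with critical point `c`. -/
def IsBadMap (c : ℝ) (T : unitInterval → unitInterval) : Prop := ∃ r, IsBadMapOfOrder c r T

open Classical in
/-- The set `Σ_G` of the indices of the good maps. -/
def goodIndices {N : ℕ} (c : ℝ) (T : Fin N → unitInterval → unitInterval) : Finset (Fin N) :=
  Finset.univ.filter fun j => IsGoodMap c (T j)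

open Classical in
/-- The set `Σ_B` of the indices of the bad maps. -/
def badIndices {N : ℕ} (c : ℝ) (T : Fin N → unitInterval → unitInterval) : Finset (Fin N) :=
  Finset.univ.filter fun j => IsBadMap c (T j)

/-- The operator `P ν = ∑_j p_j (ν ∘ T_j⁻¹)` on Borel measures on `[0,1]`. -/
def markovOp {N : ℕ} (p : Fin N → ℝ) (T : Fin N → unitInterval → unitInterval)
    (ν : Measure unitInterval) : Measure unitInterval :=
  ∑ j, ENNReal.ofReal (p j) • ν.map (T j)

/-- `λ_n = P^n λ`, where `λ` is Lebesgue measure on `[0,1]`. -/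
def lebIter {N : ℕ} (p : Fin N → ℝ) (T : Fin N → unitInterval → unitInterval) (n : ℕ) :
    Measure unitInterval :=
  (markovOp p T)^[n] volume

/-- The product of `w` along a word `b = b_1 ⋯ b_k` (equal to `1` for the empty word). This gives
both `p_b` and `ℓ_b`. -/
def wordProd {N k : ℕ} {S : Finset (Fin N)} (w : Fin N → ℝ) (b : Fin k → S) : ℝ :=
  ∏ i, w (b i)

/-- Maps satisfying the branch conditions are Borel, so that the push-forwards in `markovOp` are
the true ones. -/
theorem BranchConditions.measurable {c r : ℝ} {T : unitInterval → unitInterval} (hc0 : 0 < c)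
    (hc1 : c < 1) (h : BranchConditions c r (toReal T)) : Measurable T := by
  refine measurable_of_continuousOn_compl_singleton (⟨c, hc0.le, hc1.le⟩ : unitInterval) ?_
  intro x hx
  apply ContinuousAt.continuousWithinAt
  have hT : ∀ y : unitInterval, (T y : ℝ) = toReal T y := fun y => by
    simp [toReal, projIcc_val]
  rw [Topology.IsInducing.subtypeVal.continuousAt_iff]
  have he : ((↑) : unitInterval → ℝ) ∘ T = fun y : unitInterval => toReal T y := funext hT
  change ContinuousAt (((↑) : unitInterval → ℝ) ∘ T) x
  rw [he]
  have hne : (x : ℝ) ≠ c := fun e => hx (Subtype.ext e)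
  rcases lt_or_gt_of_ne hne with hlt | hgt
  · have h1 := h.schwarzian_left.1.continuousOn x ⟨x.2.1, hlt⟩
    refine h1.tendsto.comp (tendsto_nhdsWithin_iff.2
      ⟨continuous_subtype_val.continuousAt, ?_⟩)
    filter_upwards [(isOpen_Iio.preimage continuous_subtype_val).mem_nhds
      (show x ∈ ((↑) : unitInterval → ℝ) ⁻¹' Iio c from hlt)] with y hy
    exact ⟨y.2.1, hy⟩
  · have h1 := h.schwarzian_right.1.continuousOn x ⟨hgt, x.2.2⟩
    refine h1.tendsto.comp (tendsto_nhdsWithin_iff.2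
      ⟨continuous_subtype_val.continuousAt, ?_⟩)
    filter_upwards [(isOpen_Ioi.preimage continuous_subtype_val).mem_nhds
      (show x ∈ ((↑) : unitInterval → ℝ) ⁻¹' Ioi c from hgt)] with y hy
    exact ⟨hy, y.2.2⟩

end CriticalIntermittency

end

noncomputable section

namespace CriticalIntermittency

open Filter Topology

/-! Every $\lambda_n$ has a density $\rho$ which, on each component $(a,b)$ of
$(0,1)\setminus\{c\}$, satisfies a Harnack inequality from either side: $\rho(x)(x-a)^2$ increases
and $\rho(x)(b-x)^2$ decreases. Constants do so, sums preserve it, and so does push-forward by a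
branch, because $\mathbf Sf\le0$ makes $|Df|^{-1/2}$ convex, which gives a Koebe principle in
monotone form. As the mass is at most one, the densities are bounded, uniformly in $n$, away from
$0,c,1$ (`IntermittentSystem.exists_middle_bound`). Sets near $c$ and near the end points are
treated by induction on $n$, through $\lambda_{n+1}(A)=\sum_j p_j\lambda_n(T_j^{-1}A)$.

Near $c$, a good preimage lies in the middle region; a bad one lies there or near $c$ again, with
measure at most $\kappa\lambda(A)^{1/\ell_b}$. This recursion is modelled by $W(s)=s+\sum_b
p_bW(s^{1/\ell_b})$, solved by $W(s)=\sum_{\mathbf b}p_{\mathbf b}s^{1/\ell_{\mathbf b}}$. The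
constants $\kappa$ would accumulate along words; since $\ell_b>1$, a rescaling of Lebesgue measure
removes them (`exists_rescaling`).

Near the end points, a preimage lies near an end point, its part near each one being contracted by
some $\rho<1$, or, for good maps only, near $c$ with measure of order $\lambda(A)^{1/r_g}$, where
$W$ applies. Summing the contributions $(\rho^ms)^{1/(\ell_{\mathbf b}r_g)}$ over $m$ costs a factor
of order $\ell_{\mathbf b}r_g/(1-\rho)$: this is the origin of the weight $\ell_{\mathbf b}$.
Bernoulli's inequality makes it a term-by-term estimate (`weightedWordSeries_contract`). -/

/-! ### Koebe principle in monotone form -/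

theorem koebe_antitoneOn_right {a b β : ℝ} {f v v' : ℝ → ℝ} (hv : ConvexOn ℝ (Ioo a b) v)
    (hv0 : ∀ x ∈ Ioo a b, 0 < v x) (hv' : ∀ x ∈ Ioo a b, HasDerivAt v (v' x) x)
    (hf : ∀ x ∈ Ioo a b, HasDerivAt f ((v x ^ 2)⁻¹) x)
    (hlt : ∀ x ∈ Ioo a b, f x < β) (hsurj : ∀ y < β, ∃ x ∈ Ioo a b, y < f x) :
    AntitoneOn (fun x => v x * (β - f x) / (b - x)) (Ioo a b) := by
  have hmono : MonotoneOn f (Ioo a b) := by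
    refine monotoneOn_of_hasDerivWithinAt_nonneg (f' := fun x => (v x ^ 2)⁻¹) (convex_Ioo a b)
      (fun x hx => (hf x hx).continuousAt.continuousWithinAt) ?_ ?_
    · intro x hx
      rw [interior_Ioo] at hx ⊢
      exact (hf x hx).hasDerivWithinAt
    · intro x _
      positivity
  -- The convex `v` lies above its tangent at `x`, so `Df = v⁻²` lies below the derivative of a
  -- Möbius map on the right of `x`; integration up to `b` gives the bound. It is exactly what makes
  -- the derivative of the quotient in the conclusion non-positive. As `f` has no value at `b`, the
  -- comparison is made at points `t` with `f t` close to `β`.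
  have key : ∀ x ∈ Ioo a b, 0 < v x + v' x * (b - x) →
      β - f x ≤ (b - x) / (v x * (v x + v' x * (b - x))) := by
    intro x hx hpos
    have hvx := hv0 x hx
    have hbx : 0 < b - x := sub_pos.2 hx.2
    have hR : 0 ≤ (b - x) / (v x * (v x + v' x * (b - x))) := by positivity
    rw [sub_le_iff_le_add]
    refine le_of_forall_lt fun y hy => ?_
    obtain ⟨t, ht, hyt⟩ := hsurj y hy
    refine hyt.trans_le ?_
    rcases le_total t x with htx | hxt
    · have := hmono ht hx htx
      linarith
    have hlin : ∀ s ∈ Icc x t, 0 < v x + v' x * (s - x) := by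
      intro s hs
      have h1 : s < b := hs.2.trans_lt ht.2
      rcases le_total 0 (v' x) with h | h
      · have := mul_nonneg h (sub_nonneg.2 hs.1)
        linarith
      · nlinarith
    have htan : ∀ s ∈ Icc x t, v x + v' x * (s - x) ≤ v s := by
      intro s hs
      rcases hs.1.eq_or_lt with rfl | hxs
      · simp
      have h1 := hv.le_slope_of_hasDerivAt hx ⟨hx.1.trans hxs, hs.2.trans_lt ht.2⟩ hxs (hv' x hx)
      rw [slope_def_field, le_div_iff₀ (sub_pos.2 hxs)] at h1
      linarith
    have hq : ∀ s ∈ Icc x t, HasDerivAt (fun s => (s - x) / (v x * (v x + v' x * (s - x))) - f s)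
        (((v x + v' x * (s - x)) ^ 2)⁻¹ - (v s ^ 2)⁻¹) s := by
      intro s hs
      have hs' : s ∈ Ioo a b := ⟨hx.1.trans_le hs.1, hs.2.trans_lt ht.2⟩
      have hl := hlin s hs
      have h1 : HasDerivAt (fun s : ℝ => s - x) 1 s := (hasDerivAt_id s).sub_const x
      have h2 : HasDerivAt (fun s : ℝ => v x * (v x + v' x * (s - x))) (v x * (v' x * 1)) s :=
        ((h1.const_mul (v' x)).const_add (v x)).const_mul (v x)
      refine ((h1.div h2 (by positivity)).sub (hf s hs')).congr_deriv ?_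
      field_simp
      ring
    have hm : MonotoneOn (fun s => (s - x) / (v x * (v x + v' x * (s - x))) - f s) (Icc x t) := by
      refine monotoneOn_of_hasDerivWithinAt_nonneg
        (f' := fun s => ((v x + v' x * (s - x)) ^ 2)⁻¹ - (v s ^ 2)⁻¹) (convex_Icc x t)
        (fun s hs => (hq s hs).continuousAt.continuousWithinAt) ?_ ?_
      · intro s hs
        exact (hq s (interior_subset hs)).hasDerivWithinAt
      · intro s hs
        have hs := interior_subset hs
        have h1 := hlin s hs
        have h2 := htan s hs
        rw [sub_nonneg]
        gcongr
    have h3 := hm (left_mem_Icc.2 hxt) (right_mem_Icc.2 hxt) hxt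
    simp only [sub_self, zero_div, zero_sub] at h3
    have h4 := hlin t (right_mem_Icc.2 hxt)
    have h5 : (t - x) / (v x * (v x + v' x * (t - x))) ≤
        (b - x) / (v x * (v x + v' x * (b - x))) := by
      rw [div_le_div_iff₀ (by positivity) (by positivity)]
      have := mul_nonneg (mul_nonneg hvx.le hvx.le) (sub_nonneg.2 ht.2.le)
      nlinarith
    linarith
  have hder : ∀ x ∈ Ioo a b, HasDerivAt (fun x => v x * (β - f x) / (b - x))
      (((v' x * (β - f x) + v x * (-(v x ^ 2)⁻¹)) * (b - x) - v x * (β - f x) * (-1))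
        / (b - x) ^ 2) x := by
    intro x hx
    exact ((hv' x hx).mul ((hf x hx).const_sub β)).div ((hasDerivAt_id x).const_sub b)
      (sub_pos.2 hx.2).ne'
  refine antitoneOn_of_hasDerivWithinAt_nonpos (convex_Ioo a b)
    (fun x hx => (hder x hx).continuousAt.continuousWithinAt)
    (fun x hx => (hder x (interior_subset hx)).hasDerivWithinAt) ?_
  intro x hx
  have hx := interior_subset hx
  have hvx := hv0 x hx
  have hbx : 0 < b - x := sub_pos.2 hx.2
  refine div_nonpos_of_nonpos_of_nonneg ?_ (sq_nonneg _)
  have e : (v' x * (β - f x) + v x * (-(v x ^ 2)⁻¹)) * (b - x) - v x * (β - f x) * (-1)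
      = (β - f x) * (v x + v' x * (b - x)) - (b - x) / v x := by
    field_simp
    ring
  rw [e, sub_nonpos]
  have hR : 0 ≤ (b - x) / v x := by positivity
  rcases le_or_gt (v x + v' x * (b - x)) 0 with h | h
  · exact (mul_nonpos_of_nonneg_of_nonpos (sub_pos.2 (hlt x hx)).le h).trans hR
  · have h1 := mul_le_mul_of_nonneg_right (key x hx h) h.le
    refine h1.trans_eq ?_
    rw [← div_div, div_mul_cancel₀ _ h.ne']

theorem koebe_monotoneOn_left {a b α : ℝ} {f v v' : ℝ → ℝ} (hv : ConvexOn ℝ (Ioo a b) v)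
    (hv0 : ∀ x ∈ Ioo a b, 0 < v x) (hv' : ∀ x ∈ Ioo a b, HasDerivAt v (v' x) x)
    (hf : ∀ x ∈ Ioo a b, HasDerivAt f ((v x ^ 2)⁻¹) x)
    (hlt : ∀ x ∈ Ioo a b, α < f x) (hsurj : ∀ y, α < y → ∃ x ∈ Ioo a b, f x < y) :
    MonotoneOn (fun x => v x * (f x - α) / (x - a)) (Ioo a b) := by
  have hneg : ∀ x ∈ Ioo (-b) (-a), -x ∈ Ioo a b := fun x hx =>
    ⟨by linarith [hx.2], by linarith [hx.1]⟩
  have h := koebe_antitoneOn_right (a := -b) (b := -a) (β := -α) (f := fun x => - f (-x))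
    (v := fun x => v (-x)) (v' := fun x => - v' (-x)) ?_ (fun x hx => hv0 _ (hneg x hx)) ?_ ?_
    (fun x hx => neg_lt_neg (hlt _ (hneg x hx))) ?_
  · intro x hx y hy hxy
    have h1 := h (a := -y) ⟨neg_lt_neg hy.2, neg_lt_neg hy.1⟩ (b := -x)
      ⟨neg_lt_neg hx.2, neg_lt_neg hx.1⟩ (neg_le_neg hxy)
    simp only [neg_neg] at h1
    have e : ∀ z, v z * (f z - α) / (z - a) = v z * (-α - -f z) / (-a - -z) := fun z => by
      ring_nf
    simp only [e]
    exact h1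
  · refine ⟨convex_Ioo _ _, fun x hx y hy s t hs ht hst => ?_⟩
    have := hv.2 (hneg x hx) (hneg y hy) hs ht hst
    simp only [smul_eq_mul] at this ⊢
    convert this using 2
    ring
  · intro x hx
    have := (hv' _ (hneg x hx)).comp x (hasDerivAt_neg x)
    simpa [Function.comp_def] using this
  · intro x hx
    exact ((hf _ (hneg x hx)).comp x (hasDerivAt_neg x)).neg.congr_deriv (by simp)
  · intro y hy
    obtain ⟨x, hx, hxy⟩ := hsurj (-y) (by linarith)
    exact ⟨-x, ⟨neg_lt_neg hx.2, neg_lt_neg hx.1⟩, by simp only [neg_neg]; linarith⟩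

/-! ### The Harnack cone of densities -/

/-- Non-negative functions on `(a,b)` with the one-sided Harnack inequalities that hold for the
densities of push-forwards of Lebesgue measure by branches with non-positive Schwarzian
derivative. -/
structure HarnackCone (a b : ℝ) (ρ : ℝ → ENNReal) : Prop where
  left : MonotoneOn (fun x => ρ x * ENNReal.ofReal ((x - a) ^ 2)) (Ioo a b)
  right : AntitoneOn (fun x => ρ x * ENNReal.ofReal ((b - x) ^ 2)) (Ioo a b)

theorem HarnackCone.const {a b : ℝ} (k : ENNReal) : HarnackCone a b fun _ => k where
  left := fun x hx y hy hxy => by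
    have := hx.1
    dsimp only
    gcongr
  right := fun x hx y hy hxy => by
    have := hy.2
    dsimp only
    gcongr

theorem HarnackCone.congr {a b : ℝ} {ρ σ : ℝ → ENNReal} (h : HarnackCone a b ρ)
    (e : EqOn ρ σ (Ioo a b)) : HarnackCone a b σ where
  left := h.left.congr fun x hx => by simp only [e hx]
  right := h.right.congr fun x hx => by simp only [e hx]

theorem HarnackCone.add {a b : ℝ} {ρ σ : ℝ → ENNReal} (h : HarnackCone a b ρ)
    (h' : HarnackCone a b σ) : HarnackCone a b fun x => ρ x + σ x where
  left := fun x hx y hy hxy => by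
    simp only [add_mul]
    exact add_le_add (h.left hx hy hxy) (h'.left hx hy hxy)
  right := fun x hx y hy hxy => by
    simp only [add_mul]
    exact add_le_add (h.right hx hy hxy) (h'.right hx hy hxy)

theorem HarnackCone.const_mul {a b : ℝ} {ρ : ℝ → ENNReal} (h : HarnackCone a b ρ) (k : ENNReal) :
    HarnackCone a b fun x => k * ρ x where
  left := fun x hx y hy hxy => by
    simp only [mul_assoc]
    exact mul_le_mul_right (h.left hx hy hxy) k
  right := fun x hx y hy hxy => by
    simp only [mul_assoc]
    exact mul_le_mul_right (h.right hx hy hxy) k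

theorem HarnackCone.sum {ι : Type*} {a b : ℝ} (s : Finset ι) {ρ : ι → ℝ → ENNReal}
    (h : ∀ i ∈ s, HarnackCone a b (ρ i)) : HarnackCone a b fun x => ∑ i ∈ s, ρ i x where
  left := fun x hx y hy hxy => by
    simp only [Finset.sum_mul]
    exact Finset.sum_le_sum fun i hi => (h i hi).left hx hy hxy
  right := fun x hx y hy hxy => by
    simp only [Finset.sum_mul]
    exact Finset.sum_le_sum fun i hi => (h i hi).right hx hy hxy

theorem ofReal_sq_eq_mul {x y : ℝ} (hy : y ≠ 0) :
    ENNReal.ofReal (x ^ 2) = ENNReal.ofReal (y ^ 2) * ENNReal.ofReal ((x / y) ^ 2) := by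
  rw [← ENNReal.ofReal_mul (sq_nonneg y)]
  congr 1
  field_simp

/-- For `a ≥ α` the quotient `(x - a) / (x - α)` is itself increasing, so its square may be
multiplied into the weight; symmetrically on the right. -/
theorem HarnackCone.mono {a b α β : ℝ} {ρ : ℝ → ENNReal} (h : HarnackCone α β ρ) (ha : α ≤ a)
    (hb : b ≤ β) : HarnackCone a b ρ where
  left := fun x hx y hy hxy => by
    have hx' : x ∈ Ioo α β := ⟨ha.trans_lt hx.1, hx.2.trans_le hb⟩
    have hy' : y ∈ Ioo α β := ⟨ha.trans_lt hy.1, hy.2.trans_le hb⟩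
    have h1 : 0 < x - α := sub_pos.2 hx'.1
    have h2 : 0 < y - α := sub_pos.2 hy'.1
    have h3 : 0 < x - a := sub_pos.2 hx.1
    dsimp only
    rw [ofReal_sq_eq_mul h1.ne', ofReal_sq_eq_mul (x := y - a) h2.ne', ← mul_assoc, ← mul_assoc]
    refine mul_le_mul' (h.left hx' hy' hxy) (ENNReal.ofReal_le_ofReal ?_)
    refine pow_le_pow_left₀ (by positivity) ?_ 2
    rw [div_le_div_iff₀ h1 h2]
    nlinarith
  right := fun x hx y hy hxy => by
    have hx' : x ∈ Ioo α β := ⟨ha.trans_lt hx.1, hx.2.trans_le hb⟩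
    have hy' : y ∈ Ioo α β := ⟨ha.trans_lt hy.1, hy.2.trans_le hb⟩
    have h1 : 0 < β - x := sub_pos.2 hx'.2
    have h2 : 0 < β - y := sub_pos.2 hy'.2
    have h3 : 0 < b - y := sub_pos.2 hy.2
    dsimp only
    rw [ofReal_sq_eq_mul h2.ne', ofReal_sq_eq_mul (x := b - x) h1.ne', ← mul_assoc, ← mul_assoc]
    refine mul_le_mul' (h.right hx' hy' hxy) (ENNReal.ofReal_le_ofReal ?_)
    refine pow_le_pow_left₀ (by positivity) ?_ 2
    rw [div_le_div_iff₀ h2 h1]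
    nlinarith

/-- The push-forward of a density in the Harnack cone by an increasing branch is in the cone. -/
theorem HarnackCone.push_increasing {a b α β : ℝ} {f v v' : ℝ → ℝ} {ρ σ : ℝ → ENNReal}
    (hρ : HarnackCone a b ρ) (hbij : BijOn f (Ioo a b) (Ioo α β))
    (hv : ConvexOn ℝ (Ioo a b) v)
    (hv0 : ∀ x ∈ Ioo a b, 0 < v x) (hv' : ∀ x ∈ Ioo a b, HasDerivAt v (v' x) x)
    (hf : ∀ x ∈ Ioo a b, HasDerivAt f ((v x ^ 2)⁻¹) x)
    (hσ : ∀ x ∈ Ioo a b, σ (f x) = ρ x * ENNReal.ofReal (v x ^ 2)) : HarnackCone α β σ := by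
  have hmono : StrictMonoOn f (Ioo a b) := by
    refine strictMonoOn_of_deriv_pos (convex_Ioo a b)
      (fun x hx => (hf x hx).continuousAt.continuousWithinAt) ?_
    intro x hx
    have hx := interior_subset hx
    rw [(hf x hx).deriv]
    have := hv0 x hx
    positivity
  have hord : ∀ x ∈ Ioo a b, ∀ y ∈ Ioo a b, f x ≤ f y → x ≤ y := fun x hx y hy h =>
    (hmono.le_iff_le hx hy).1 h
  constructor
  · intro y₁ hy₁ y₂ hy₂ hle
    obtain ⟨x₁, hx₁, rfl⟩ := hbij.surjOn hy₁
    obtain ⟨x₂, hx₂, rfl⟩ := hbij.surjOn hy₂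
    have hx := hord _ hx₁ _ hx₂ hle
    have hK := koebe_monotoneOn_left hv hv0 hv' hf (fun x hx => (hbij.mapsTo hx).1) (α := α) ?_
      hx₁ hx₂ hx
    -- The weighted new density is the weighted old density times the square of the Koebe quotient,
    -- and both factors are increasing.
    · have e : ∀ x ∈ Ioo a b, σ (f x) * ENNReal.ofReal ((f x - α) ^ 2) =
          ρ x * ENNReal.ofReal ((x - a) ^ 2)
            * ENNReal.ofReal ((v x * (f x - α) / (x - a)) ^ 2) := by
        intro x hx
        have h1 : x - a ≠ 0 := (sub_pos.2 hx.1).ne'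
        rw [mul_assoc, ← ofReal_sq_eq_mul h1, mul_pow, ENNReal.ofReal_mul (sq_nonneg _), hσ x hx,
          mul_assoc]
      simp only [e _ hx₁, e _ hx₂]
      refine mul_le_mul' (hρ.left hx₁ hx₂ hx) (ENNReal.ofReal_le_ofReal ?_)
      refine pow_le_pow_left₀ ?_ hK 2
      have h1 := sub_pos.2 hx₁.1
      have h2 := hv0 _ hx₁
      have h3 := sub_pos.2 hy₁.1
      positivity
    · intro y hy
      obtain ⟨z, hz, hz'⟩ := exists_between (lt_min hy (hy₁.1.trans hy₁.2))
      obtain ⟨x, hx, rfl⟩ := hbij.surjOn (show z ∈ Ioo α β from ⟨hz, hz'.trans_le (min_le_right _ _)⟩)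
      exact ⟨x, hx, hz'.trans_le (min_le_left _ _)⟩
  · intro y₁ hy₁ y₂ hy₂ hle
    obtain ⟨x₁, hx₁, rfl⟩ := hbij.surjOn hy₁
    obtain ⟨x₂, hx₂, rfl⟩ := hbij.surjOn hy₂
    have hx := hord _ hx₁ _ hx₂ hle
    have hK := koebe_antitoneOn_right hv hv0 hv' hf (fun x hx => (hbij.mapsTo hx).2) (β := β) ?_
      hx₁ hx₂ hx
    · have e : ∀ x ∈ Ioo a b, σ (f x) * ENNReal.ofReal ((β - f x) ^ 2) =
          ρ x * ENNReal.ofReal ((b - x) ^ 2)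
            * ENNReal.ofReal ((v x * (β - f x) / (b - x)) ^ 2) := by
        intro x hx
        have h1 : b - x ≠ 0 := (sub_pos.2 hx.2).ne'
        rw [mul_assoc, ← ofReal_sq_eq_mul h1, mul_pow, ENNReal.ofReal_mul (sq_nonneg _), hσ x hx,
          mul_assoc]
      simp only [e _ hx₁, e _ hx₂]
      refine mul_le_mul' (hρ.right hx₁ hx₂ hx) (ENNReal.ofReal_le_ofReal ?_)
      refine pow_le_pow_left₀ ?_ hK 2
      have h1 := sub_pos.2 hx₂.2
      have h2 := hv0 _ hx₂
      have h3 := sub_pos.2 hy₂.2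
      positivity
    · intro y hy
      obtain ⟨z, hz, hz'⟩ := exists_between (max_lt hy (hy₁.1.trans hy₁.2))
      obtain ⟨x, hx, rfl⟩ := hbij.surjOn (show z ∈ Ioo α β from ⟨(le_max_right _ _).trans_lt hz, hz'⟩)
      exact ⟨x, hx, (le_max_left _ _).trans_lt hz⟩

theorem HarnackCone.comp_neg {a b : ℝ} {ρ : ℝ → ENNReal} (h : HarnackCone a b ρ) :
    HarnackCone (-b) (-a) fun x => ρ (-x) where
  left := fun x hx y hy hxy => by
    have h0 := h.right
    have := h0 (a := -y) ⟨by linarith [hy.2], by linarith [hy.1]⟩ (b := -x)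
      ⟨by linarith [hx.2], by linarith [hx.1]⟩ (neg_le_neg hxy)
    simp only [sub_neg_eq_add] at this ⊢
    simpa only [add_comm] using this
  right := fun x hx y hy hxy => by
    have h0 := h.left
    have := h0 (a := -y) ⟨by linarith [hy.2], by linarith [hy.1]⟩ (b := -x)
      ⟨by linarith [hx.2], by linarith [hx.1]⟩ (neg_le_neg hxy)
    have e : ∀ z : ℝ, (-a - z) = (-z - a) := fun z => by ring
    simpa only [e] using this

theorem HarnackCone.push_decreasing {a b α β : ℝ} {f v v' : ℝ → ℝ} {ρ σ : ℝ → ENNReal}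
    (hρ : HarnackCone a b ρ) (hbij : BijOn f (Ioo a b) (Ioo α β))
    (hv : ConvexOn ℝ (Ioo a b) v)
    (hv0 : ∀ x ∈ Ioo a b, 0 < v x) (hv' : ∀ x ∈ Ioo a b, HasDerivAt v (v' x) x)
    (hf : ∀ x ∈ Ioo a b, HasDerivAt f (-(v x ^ 2)⁻¹) x)
    (hσ : ∀ x ∈ Ioo a b, σ (f x) = ρ x * ENNReal.ofReal (v x ^ 2)) : HarnackCone α β σ := by
  have hbij' : BijOn (fun x => - f x) (Ioo a b) (Ioo (-β) (-α)) := by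
    refine ⟨fun x hx => ⟨neg_lt_neg (hbij.mapsTo hx).2, neg_lt_neg (hbij.mapsTo hx).1⟩,
      fun x hx y hy h => hbij.injOn hx hy (neg_injective h), fun y hy => ?_⟩
    obtain ⟨x, hx, h⟩ := hbij.surjOn
      (show -y ∈ Ioo α β from ⟨by linarith [hy.2], by linarith [hy.1]⟩)
    exact ⟨x, hx, by simp [h]⟩
  have h := hρ.push_increasing (σ := fun y => σ (-y)) hbij' hv hv0 hv'
    (fun x hx => (hf x hx).neg.congr_deriv (neg_neg _)) (fun x hx => by simpa using hσ x hx)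
  simpa using h.comp_neg

/-- The left inequality prevents `ρ` from dropping much to the right of `x`: there it is at least `ρ
x * ((x - a) / (b - a)) ^ 2`. Integration over `(x, b)` bounds `ρ x` by the mass. -/
theorem HarnackCone.le_of_lintegral_le_one {a b : ℝ} {ρ : ℝ → ENNReal} (h : HarnackCone a b ρ)
    (hint : ∫⁻ x in Ioo a b, ρ x ≤ 1) {x : ℝ} (hx : x ∈ Ioo a b) :
    ρ x ≤ ENNReal.ofReal ((b - a) ^ 2 / ((x - a) ^ 2 * (b - x))) := by
  have hxa : 0 < x - a := sub_pos.2 hx.1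
  have hbx : 0 < b - x := sub_pos.2 hx.2
  have hba : 0 < b - a := by linarith
  have h1 : ∀ y ∈ Ioo x b, ρ x * ENNReal.ofReal ((x - a) ^ 2 / (b - a) ^ 2) ≤ ρ y := by
    intro y hy
    have hy' : y ∈ Ioo a b := ⟨hx.1.trans hy.1, hy.2⟩
    have h2 := h.left hx hy' hy.1.le
    have h3 : ρ y * ENNReal.ofReal ((y - a) ^ 2) ≤ ρ y * ENNReal.ofReal ((b - a) ^ 2) := by
      have := hy'.1
      have := hy'.2.le
      gcongr
    rw [ENNReal.ofReal_div_of_pos (by positivity), ← mul_div_assoc]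
    exact ENNReal.div_le_of_le_mul (h2.trans h3)
  have h2 : ρ x * ENNReal.ofReal ((x - a) ^ 2 / (b - a) ^ 2) * ENNReal.ofReal (b - x) ≤ 1 := by
    rw [← Real.volume_Ioo, ← setLIntegral_const]
    exact ((setLIntegral_mono' measurableSet_Ioo h1).trans
      (lintegral_mono_set (Ioo_subset_Ioo_left hx.1.le))).trans hint
  rw [mul_assoc, ← ENNReal.ofReal_mul (by positivity)] at h2
  have h4 : (b - a) ^ 2 / ((x - a) ^ 2 * (b - x)) = ((x - a) ^ 2 / (b - a) ^ 2 * (b - x))⁻¹ := by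
    field_simp
  rw [h4, ENNReal.ofReal_inv_of_pos (by positivity)]
  exact ENNReal.le_inv_iff_mul_le.2 h2

/-! ### Non-positive Schwarzian derivative and push-forward of densities -/

theorem NonposSchwarzian.hasDerivAt_iteratedDerivWithin {f : ℝ → ℝ} {J U : Set ℝ}
    (h : NonposSchwarzian f J) (hJ : UniqueDiffOn ℝ J) (hU : IsOpen U) (hUJ : U ⊆ J) {m : ℕ}
    (hm : m < 3) {x : ℝ} (hx : x ∈ U) :
    HasDerivAt (iteratedDerivWithin m f J) (iteratedDerivWithin (m + 1) f J x) x := by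
  have h1 := h.1.differentiableOn_iteratedDerivWithin (m := m) (by exact_mod_cast hm) hJ x (hUJ hx)
  rw [iteratedDerivWithin_succ]
  exact h1.hasDerivWithinAt.hasDerivAt (Filter.mem_of_superset (hU.mem_nhds hx) hUJ)

theorem NonposSchwarzian.hasDerivAt {f : ℝ → ℝ} {J U : Set ℝ}
    (h : NonposSchwarzian f J) (hJ : UniqueDiffOn ℝ J) (hU : IsOpen U) (hUJ : U ⊆ J)
    {x : ℝ} (hx : x ∈ U) : HasDerivAt f (derivWithin f J x) x := by
  simpa using h.hasDerivAt_iteratedDerivWithin hJ hU hUJ (m := 0) (by norm_num) hx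

theorem NonposSchwarzian.hasDerivWithinAt {f : ℝ → ℝ} {J : Set ℝ}
    (h : NonposSchwarzian f J) {x : ℝ} (hx : x ∈ J) :
    HasDerivWithinAt f (derivWithin f J x) J x :=
  ((h.1.differentiableOn (by norm_num)) x hx).hasDerivWithinAt

/-- For a branch with non-positive Schwarzian derivative, `|Df|^(-1/2)` is convex. -/
theorem NonposSchwarzian.exists_convex {f : ℝ → ℝ} {J : Set ℝ} {a b s : ℝ}
    (h : NonposSchwarzian f J) (hJ : UniqueDiffOn ℝ J) (hUJ : Ioo a b ⊆ J)
    (hs : s * s = 1) (hpos : ∀ x ∈ Ioo a b, 0 < s * derivWithin f J x) :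
    ∃ v v' : ℝ → ℝ, ConvexOn ℝ (Ioo a b) v ∧ (∀ x ∈ Ioo a b, 0 < v x) ∧
      (∀ x ∈ Ioo a b, HasDerivAt v (v' x) x) ∧
      ∀ x ∈ Ioo a b, v x ^ 2 = (s * derivWithin f J x)⁻¹ := by
  set D := derivWithin f J
  set D2 := iteratedDerivWithin 2 f J
  set D3 := iteratedDerivWithin 3 f J
  have hs0 : s ≠ 0 := by rintro rfl; simp at hs
  have h1 : ∀ x ∈ Ioo a b, HasDerivAt (fun x => s * D x) (s * D2 x) x := fun x hx => by
    have := h.hasDerivAt_iteratedDerivWithin hJ isOpen_Ioo hUJ (m := 1) (by norm_num) hx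
    rw [iteratedDerivWithin_one] at this
    exact this.const_mul s
  have h2 : ∀ x ∈ Ioo a b, HasDerivAt (fun x => s * D2 x) (s * D3 x) x := fun x hx =>
    (h.hasDerivAt_iteratedDerivWithin hJ isOpen_Ioo hUJ (m := 2) (by norm_num) hx).const_mul s
  have hv' : ∀ x ∈ Ioo a b, HasDerivAt (fun x => (s * D x) ^ (-1 / 2 : ℝ))
      (s * D2 x * (-1 / 2) * (s * D x) ^ (-3 / 2 : ℝ)) x := fun x hx => by
    convert (h1 x hx).rpow_const (p := -1 / 2) (Or.inl (hpos x hx).ne') using 2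
    norm_num
  have hv'' : ∀ x ∈ Ioo a b, HasDerivAt (fun x => s * D2 x * (-1 / 2) * (s * D x) ^ (-3 / 2 : ℝ))
      (s * D3 x * (-1 / 2) * (s * D x) ^ (-3 / 2 : ℝ) + s * D2 x * (-1 / 2) *
        (s * D2 x * (-3 / 2) * (s * D x) ^ (-5 / 2 : ℝ))) x := fun x hx => by
    have h3 := (h1 x hx).rpow_const (p := -3 / 2) (Or.inl (hpos x hx).ne')
    have e : (-3 / 2 - 1 : ℝ) = -5 / 2 := by norm_num
    rw [e] at h3
    exact ((h2 x hx).mul_const (-1 / 2)).mul h3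
  refine ⟨fun x => (s * D x) ^ (-1 / 2 : ℝ), fun x => s * D2 x * (-1 / 2) * (s * D x) ^ (-3 / 2 : ℝ),
    ?_, fun x hx => Real.rpow_pos_of_pos (hpos x hx) _, hv', fun x hx => ?_⟩
  · refine convexOn_of_hasDerivWithinAt2_nonneg (convex_Ioo a b)
      (fun x hx => (hv' x hx).continuousAt.continuousWithinAt)
      (fun x hx => (hv' x (interior_subset hx)).hasDerivWithinAt)
      (fun x hx => (hv'' x (interior_subset hx)).hasDerivWithinAt) ?_
    intro x hx
    have hx := interior_subset hx
    have hp := hpos x hx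
    have hS := (h.2 x (hUJ hx)).2
    have hD0 := (h.2 x (hUJ hx)).1
    change D x ≠ 0 at hD0
    change D3 x / D x - 3 / 2 * (D2 x / D x) ^ 2 ≤ 0 at hS
    have e3 : (s * D x) ^ (-3 / 2 : ℝ) = (s * D x) * (s * D x) ^ (-5 / 2 : ℝ) := by
      have : (-3 / 2 : ℝ) = 1 + -5 / 2 := by norm_num
      rw [this, Real.rpow_add hp, Real.rpow_one]
    have hq : 0 < (s * D x) ^ (-5 / 2 : ℝ) := Real.rpow_pos_of_pos hp _
    -- This is $v''=-\frac12v\,\mathbf Sf$ for $v=|Df|^{-1/2}$; the sign `s` of the derivative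
    -- treats both orientations at once.
    have e4 : s * D3 x * (-1 / 2) * (s * D x) ^ (-3 / 2 : ℝ) + s * D2 x * (-1 / 2) *
        (s * D2 x * (-3 / 2) * (s * D x) ^ (-5 / 2 : ℝ)) =
        (s * D x) ^ (-5 / 2 : ℝ) * ((1 / 2) * (s * s) * D x ^ 2 *
          -(D3 x / D x - 3 / 2 * (D2 x / D x) ^ 2)) := by
      rw [e3]
      field_simp
      ring
    rw [e4, hs]
    have := neg_nonneg.2 hS
    positivity
  · change ((s * D x) ^ (-1 / 2 : ℝ)) ^ 2 = (s * D x)⁻¹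
    rw [← Real.rpow_natCast, ← Real.rpow_mul (hpos x hx).le, ← Real.rpow_neg_one]
    norm_num

/-- A branch with non-positive Schwarzian derivative pushes densities in the Harnack cone of its
domain to densities in the Harnack cone of its image. -/
theorem NonposSchwarzian.exists_push_density {f : ℝ → ℝ} {J : Set ℝ} {a b α β : ℝ}
    (h : NonposSchwarzian f J) (hJ : UniqueDiffOn ℝ J) (hUJ : Ioo a b ⊆ J)
    (hd : IsC3Diffeo f (Ioo a b) (Ioo α β)) (hfm : Measurable f) {ρ : ℝ → ENNReal}
    (hρm : Measurable ρ) (hρ : HarnackCone a b ρ) :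
    ∃ σ : ℝ → ENNReal, Measurable σ ∧ HarnackCone α β σ ∧ (∀ y ∉ Ioo α β, σ y = 0) ∧
      ∀ A, MeasurableSet A → ∫⁻ y in A, σ y = ∫⁻ x in f ⁻¹' A ∩ Ioo a b, ρ x := by
  classical
  obtain ⟨k, hfU, hkV, hinv, -, hk3⟩ := hd
  have hbij : BijOn f (Ioo a b) (Ioo α β) := hinv.bijOn hfU hkV
  have hder : ∀ x ∈ Ioo a b, HasDerivAt f (derivWithin f J x) x := fun x hx =>
    h.hasDerivAt hJ isOpen_Ioo hUJ hx
  -- The inverse `k` is controlled only on `(α, β)`; cutting it off there makes it, and hence the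
  -- transferred density `σ`, measurable on the line.
  let k' : ℝ → ℝ := (Ioo α β).piecewise k 0
  have hk'm : Measurable k' := hk3.continuousOn.measurable_piecewise continuousOn_const
    measurableSet_Ioo
  let σ : ℝ → ENNReal := (Ioo α β).indicator
    fun y => ρ (k' y) * ENNReal.ofReal (|deriv f (k' y)|⁻¹)
  have hσm : Measurable σ := by
    refine Measurable.indicator ?_ measurableSet_Ioo
    exact (hρm.comp hk'm).mul
      (ENNReal.measurable_ofReal.comp (((measurable_deriv f).comp hk'm).norm.inv))
  have hσf : ∀ x ∈ Ioo a b, σ (f x) = ρ x * ENNReal.ofReal (|derivWithin f J x|⁻¹) := by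
    intro x hx
    have e : k' (f x) = x := by
      simp only [k', piecewise_eq_of_mem _ _ _ (hfU hx)]
      exact hinv.1 hx
    simp only [σ, indicator_of_mem (hfU hx), e, (hder x hx).deriv]
  refine ⟨σ, hσm, ?_, fun y hy => indicator_of_notMem hy _, ?_⟩
  · rcases hasDerivWithinAt_forall_lt_or_forall_gt_of_forall_ne (convex_Ioo a b)
      (fun x hx => (hder x hx).hasDerivWithinAt) (m := 0) (fun x hx => (h.2 x (hUJ hx)).1)
      with hneg | hpos
    · obtain ⟨v, v', h1, h2, h3, h4⟩ := h.exists_convex hJ hUJ (s := -1) (by norm_num)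
        (fun x hx => by have := hneg x hx; linarith)
      refine hρ.push_decreasing hbij h1 h2 h3 (fun x hx => ?_) (fun x hx => ?_)
      · rw [h4 x hx]
        exact (hder x hx).congr_deriv (by simp)
      · rw [hσf x hx, h4 x hx, abs_of_neg (hneg x hx), neg_one_mul]
    · obtain ⟨v, v', h1, h2, h3, h4⟩ := h.exists_convex hJ hUJ (s := 1) (by norm_num)
        (fun x hx => by have := hpos x hx; linarith)
      refine hρ.push_increasing hbij h1 h2 h3 (fun x hx => ?_) (fun x hx => ?_)
      · rw [h4 x hx]
        exact (hder x hx).congr_deriv (by simp)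
      · rw [hσf x hx, h4 x hx, abs_of_pos (hpos x hx), one_mul]
  · intro A hA
    have hB : MeasurableSet (f ⁻¹' A ∩ Ioo a b) := (hfm hA).inter measurableSet_Ioo
    have himg : f '' (f ⁻¹' A ∩ Ioo a b) = A ∩ Ioo α β := by
      rw [image_preimage_inter, hbij.image_eq]
    have h1 : ∫⁻ y in A, σ y = ∫⁻ y in A ∩ Ioo α β, σ y := by
      simp only [σ, setLIntegral_indicator measurableSet_Ioo]
      rw [inter_left_comm, inter_self, inter_comm]
    rw [h1, ← himg, lintegral_image_eq_lintegral_abs_deriv_mul hB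
      (fun x hx => (hder x hx.2).hasDerivWithinAt) (hbij.injOn.mono inter_subset_right)]
    refine setLIntegral_congr_fun hB fun x hx => ?_
    have hne : |derivWithin f J x| ≠ 0 := abs_ne_zero.2 (h.2 x (hUJ hx.2)).1
    rw [hσf x hx.2, mul_left_comm, ← ENNReal.ofReal_mul (abs_nonneg _), mul_inv_cancel₀ hne,
      ENNReal.ofReal_one, mul_one]

/-! ### Lebesgue measure of preimages -/

theorem volume_le_of_le_abs_deriv {f D : ℝ → ℝ} {B A : Set ℝ} {k : ℝ} (hB : MeasurableSet B)
    (hf : ∀ x ∈ B, HasDerivAt f (D x) x) (hinj : InjOn f B) (hk : ∀ x ∈ B, k ≤ |D x|)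
    (hBA : MapsTo f B A) : ENNReal.ofReal k * volume B ≤ volume A := by
  have h1 := lintegral_image_eq_lintegral_abs_deriv_mul hB
    (fun x hx => (hf x hx).hasDerivWithinAt) hinj (fun _ => 1)
  simp only [lintegral_one, Measure.restrict_apply_univ, mul_one] at h1
  calc ENNReal.ofReal k * volume B = ∫⁻ _ in B, ENNReal.ofReal k := by
        rw [setLIntegral_const]
    _ ≤ ∫⁻ x in B, ENNReal.ofReal |D x| :=
        setLIntegral_mono' hB fun x hx => ENNReal.ofReal_le_ofReal (hk x hx)
    _ ≤ volume A := h1 ▸ measure_mono hBA.image_subset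

/-- Preimages under a branch with a critical point of order `r`. -/
theorem volume_le_rpow_of_le_abs_deriv {f D : ℝ → ℝ} {B A : Set ℝ} {c r K : ℝ} (hr : 1 ≤ r)
    (hK : 0 < K) (hB : MeasurableSet B) (hB1 : B ⊆ Icc 0 1)
    (hf : ∀ x ∈ B, HasDerivAt f (D x) x) (hinj : InjOn f B)
    (hk : ∀ x ∈ B, K * |x - c| ^ (r - 1) ≤ |D x|)
    (hBA : MapsTo f B A) :
    volume B ≤ ENNReal.ofReal (4 * (2 * K)⁻¹ ^ r⁻¹) * volume A ^ r⁻¹ := by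
  have hBfin : volume B ≠ ⊤ := by
    refine ((measure_mono hB1).trans_lt ?_).ne
    simp
  have hr0 : 0 < r := by linarith
  -- With `t` a quarter of the measure of `B`, the interval `(c - t, c + t)` covers at most half of
  -- `B`. On the rest the derivative is at least `K * t ^ (r - 1)`, so the image has measure at
  -- least `2 * K * t ^ r`.
  set t : ℝ := (volume B).toReal / 4 with ht
  have ht0 : 0 ≤ t := by positivity
  have hBt : volume B = ENNReal.ofReal (4 * t) := by
    rw [ht, mul_div_cancel₀ _ (by norm_num), ENNReal.ofReal_toReal hBfin]
  set B' := B \ Ioo (c - t) (c + t) with hB'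
  have hB'v : ENNReal.ofReal (2 * t) ≤ volume B' := by
    have h1 := le_measure_sdiff (μ := (volume : Measure ℝ)) (s₁ := B) (s₂ := Ioo (c - t) (c + t))
    rw [hBt, Real.volume_Ioo, ← ENNReal.ofReal_sub _ (by linarith)] at h1
    convert h1 using 2
    ring
  have h2 : ENNReal.ofReal (K * t ^ (r - 1)) * volume B' ≤ volume A := by
    refine volume_le_of_le_abs_deriv (hB.diff measurableSet_Ioo) (fun x hx => hf x hx.1)
      (hinj.mono sdiff_subset) (fun x hx => ?_) (hBA.mono_left sdiff_subset)
    refine le_trans ?_ (hk x hx.1)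
    have h3 : t ≤ |x - c| := by
      by_contra h4
      rw [not_le, abs_lt] at h4
      exact hx.2 ⟨by linarith [h4.1], by linarith [h4.2]⟩
    have := Real.rpow_le_rpow ht0 h3 (sub_nonneg.2 hr)
    gcongr
  have h3 : ENNReal.ofReal (2 * K * t ^ r) ≤ volume A := by
    refine le_trans ?_ ((mul_le_mul_right hB'v _).trans h2)
    rw [← ENNReal.ofReal_mul (by positivity)]
    refine ENNReal.ofReal_le_ofReal (le_of_eq ?_)
    rcases ht0.eq_or_lt with h0 | h0
    · rw [← h0, Real.zero_rpow hr0.ne']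
      ring
    · rw [Real.rpow_sub_one h0.ne']
      field_simp
  have h4 : ENNReal.ofReal (t ^ r) ≤ ENNReal.ofReal (2 * K)⁻¹ * volume A := by
    have := mul_le_mul_right h3 (ENNReal.ofReal (2 * K)⁻¹)
    rwa [← ENNReal.ofReal_mul (by positivity), ← mul_assoc, inv_mul_cancel₀ (by positivity),
      one_mul] at this
  have h5 := ENNReal.rpow_le_rpow h4 (inv_nonneg.2 hr0.le)
  rw [ENNReal.ofReal_rpow_of_nonneg (by positivity) (by positivity), Real.rpow_rpow_inv ht0 hr0.ne',
    ENNReal.mul_rpow_of_nonneg _ _ (inv_nonneg.2 hr0.le),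
    ENNReal.ofReal_rpow_of_nonneg (by positivity) (by positivity)] at h5
  rw [hBt, ENNReal.ofReal_mul (by norm_num), ENNReal.ofReal_mul (by norm_num), mul_assoc]
  exact mul_le_mul_right h5 _

/-! ### Branches near the end points and near c -/

/-- `(a,b)` is one of the two components of `(0,1) \ {c}`, `e` is its end point in `{0,1}` and
`J = (a,b) ∪ {e}`. -/
structure IsSide (c e a b : ℝ) (J : Set ℝ) : Prop where
  end_eq : e = 0 ∨ e = 1
  eq_insert : J = insert e (Ioo a b)
  convex : Convex ℝ J
  uniqueDiffOn : UniqueDiffOn ℝ J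
  subset : Ioo a b ⊆ Ioo 0 1
  notMem : c ∉ Ioo a b
  end_notMem : e ∉ Ioo a b
  exists_near : ∀ δ > 0, ∃ x ∈ Ioo a b, |x - e| < δ
  min_le : ∀ x ∈ Ioo a b, min |x - e| (min c (1 - c)) ≤ min x (1 - x)
  isCompact : ∀ δ > 0, ∀ η > 0, IsCompact {x ∈ Ioo a b | δ ≤ |x - e| ∧ η ≤ |x - c|}

theorem isSide_left {c : ℝ} (hc0 : 0 < c) (hc1 : c < 1) : IsSide c 0 0 c (Ico 0 c) where
  end_eq := Or.inl rfl
  eq_insert := (Ioo_insert_left hc0).symm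
  convex := convex_Ico 0 c
  uniqueDiffOn := uniqueDiffOn_Ico 0 c
  subset := Ioo_subset_Ioo_right hc1.le
  notMem := by simp
  end_notMem := by simp
  exists_near := fun δ hδ => by
    obtain ⟨x, hx, hx'⟩ := exists_between (lt_min hδ hc0)
    exact ⟨x, ⟨hx, hx'.trans_le (min_le_right _ _)⟩, by
      rw [sub_zero, abs_of_pos hx]; exact hx'.trans_le (min_le_left _ _)⟩
  min_le := fun x hx => by
    rw [sub_zero, abs_of_pos hx.1]
    refine le_min (min_le_left _ _) ((min_le_right _ _).trans ((min_le_right _ _).trans ?_))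
    linarith [hx.2]
  isCompact := fun δ hδ η hη => by
    have : {x ∈ Ioo 0 c | δ ≤ |x - 0| ∧ η ≤ |x - c|} = Icc δ (c - η) := by
      ext x
      simp only [mem_ofPred_eq, mem_Ioo, mem_Icc, sub_zero]
      constructor
      · rintro ⟨⟨h1, h2⟩, h3, h4⟩
        rw [abs_of_pos h1] at h3
        rw [abs_of_neg (sub_neg.2 h2)] at h4
        exact ⟨h3, by linarith⟩
      · rintro ⟨h1, h2⟩
        have h3 : 0 < x := by linarith
        have h4 : x < c := by linarith
        rw [abs_of_pos h3, abs_of_neg (sub_neg.2 h4)]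
        exact ⟨⟨h3, h4⟩, h1, by linarith⟩
    rw [this]
    exact isCompact_Icc

theorem isSide_right {c : ℝ} (hc0 : 0 < c) (hc1 : c < 1) : IsSide c 1 c 1 (Ioc c 1) where
  end_eq := Or.inr rfl
  eq_insert := (Ioo_insert_right hc1).symm
  convex := convex_Ioc c 1
  uniqueDiffOn := uniqueDiffOn_Ioc c 1
  subset := Ioo_subset_Ioo_left hc0.le
  notMem := by simp
  end_notMem := by simp
  exists_near := fun δ hδ => by
    obtain ⟨x, hx, hx'⟩ := exists_between (max_lt (sub_lt_self 1 hδ) hc1)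
    refine ⟨x, ⟨(le_max_right _ _).trans_lt hx, hx'⟩, ?_⟩
    rw [abs_of_neg (sub_neg.2 hx')]
    linarith [(le_max_left _ _).trans_lt hx]
  min_le := fun x hx => by
    rw [abs_of_neg (sub_neg.2 hx.2), neg_sub]
    refine le_min ((min_le_right _ _).trans ((min_le_left _ _).trans hx.1.le)) (min_le_left _ _)
  isCompact := fun δ hδ η hη => by
    have : {x ∈ Ioo c 1 | δ ≤ |x - 1| ∧ η ≤ |x - c|} = Icc (c + η) (1 - δ) := by
      ext x
      simp only [mem_ofPred_eq, mem_Ioo, mem_Icc]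
      constructor
      · rintro ⟨⟨h1, h2⟩, h3, h4⟩
        rw [abs_of_neg (sub_neg.2 h2)] at h3
        rw [abs_of_pos (sub_pos.2 h1)] at h4
        exact ⟨by linarith, by linarith⟩
      · rintro ⟨h1, h2⟩
        have h3 : c < x := by linarith
        have h4 : x < 1 := by linarith
        rw [abs_of_neg (sub_neg.2 h4), abs_of_pos (sub_pos.2 h3)]
        exact ⟨⟨h3, h4⟩, by linarith, by linarith⟩
    rw [this]
    exact isCompact_Icc

section Side

variable {c e a b : ℝ} {J V : Set ℝ} {f : ℝ → ℝ}

theorem IsSide.Ioo_subset (hs : IsSide c e a b J) : Ioo a b ⊆ J :=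
  hs.eq_insert ▸ subset_insert _ _

theorem IsSide.end_mem (hs : IsSide c e a b J) : e ∈ J :=
  hs.eq_insert ▸ mem_insert _ _

theorem IsC3Diffeo.injOn {U : Set ℝ} (h : IsC3Diffeo f U V) : InjOn f U := by
  obtain ⟨k, -, -, hinv, -⟩ := h
  exact hinv.1.injOn

theorem IsC3Diffeo.mapsTo {U : Set ℝ} (h : IsC3Diffeo f U V) : MapsTo f U V := by
  obtain ⟨k, h, -⟩ := h
  exact h

theorem min_le_abs_sub {e x : ℝ} (he : e = 0 ∨ e = 1) : min x (1 - x) ≤ |x - e| := by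
  rcases he with rfl | rfl
  · exact (min_le_left _ _).trans (by simpa using le_abs_self x)
  · exact (min_le_right _ _).trans (by simpa using neg_le_abs (x - 1))

theorem abs_sub_le_min {e y : ℝ} (he : e = 0 ∨ e = 1) (hy : |y - e| ≤ 1 / 2) (h0 : 0 < y)
    (h1 : y < 1) : |y - e| ≤ min y (1 - y) := by
  rcases he with rfl | rfl
  · rw [sub_zero, abs_of_pos h0] at *
    exact le_min le_rfl (by linarith)
  · rw [abs_of_neg (sub_neg.2 h1)] at *
    exact le_min (by linarith) (by linarith)

/-- Expansion near an end point. -/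
theorem IsSide.expansion (hs : IsSide c e a b J) (h : NonposSchwarzian f J)
    (hexp : 1 < |derivWithin f J e|) :
    ∃ ρ : ℝ, 0 < ρ ∧ ρ < 1 ∧ ∀ ε > 0, ∃ δ > 0, ∀ x ∈ Ioo a b, |x - e| < δ →
      |x - e| < |f x - f e| ∧ |f x - f e| < ε ∧ ρ⁻¹ ≤ |derivWithin f J x| := by
  obtain ⟨q, hq1, hq⟩ := exists_between hexp
  have hq0 : 0 < q := by linarith
  refine ⟨q⁻¹, by positivity, inv_lt_one_of_one_lt₀ hq1, fun ε hε => ?_⟩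
  rw [inv_inv]
  have hJe : J \ {e} = Ioo a b := by
    rw [hs.eq_insert, insert_sdiff_of_mem _ (mem_singleton e), sdiff_singleton_eq_self hs.end_notMem]
  have hD : ContinuousOn (derivWithin f J) J :=
    h.1.continuousOn_derivWithin hs.uniqueDiffOn (by norm_num)
  have h1 : ∀ᶠ x in 𝓝[Ioo a b] e, q < |derivWithin f J x| :=
    ((hD.abs e hs.end_mem).mono hs.Ioo_subset).tendsto.eventually_const_lt hq
  have h2 : ∀ᶠ x in 𝓝[Ioo a b] e, |f x - f e| < ε := by
    have h3 : ContinuousWithinAt (fun x => |f x - f e|) (Ioo a b) e :=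
      (((h.1.continuousOn e hs.end_mem).sub continuousWithinAt_const).abs).mono hs.Ioo_subset
    have h4 := h3.tendsto
    rw [sub_self, abs_zero] at h4
    exact h4.eventually_lt_const hε
  have h3 : ∀ᶠ x in 𝓝[Ioo a b] e, |x - e| < |f x - f e| := by
    have h4 := (h.hasDerivWithinAt hs.end_mem)
    rw [hasDerivWithinAt_iff_tendsto_slope, hJe] at h4
    filter_upwards [h4.abs.eventually_const_lt hexp, self_mem_nhdsWithin] with x hx hxU
    have hne : 0 < |x - e| := abs_pos.2 (sub_ne_zero.2 fun h => hs.end_notMem (h ▸ hxU))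
    rwa [slope_def_field, abs_div, lt_div_iff₀ hne, one_mul] at hx
  obtain ⟨δ, hδ, h5⟩ := Metric.mem_nhdsWithin_iff.1 (h1.and (h2.and h3))
  refine ⟨δ, hδ, fun x hx hxδ => ?_⟩
  obtain ⟨h6, h7, h8⟩ := h5 ⟨by simpa [Real.dist_eq] using hxδ, hx⟩
  exact ⟨h8, h7, h6.le⟩

/-- Near `e` the branch moves points away from the end points, so the same `δ` serves for `x` and `f
x`. Away from `e` and `c`, compactness keeps `f x` at a positive distance from `0` and `1`. -/
theorem IsSide.good_end (hs : IsSide c e a b J) (h : NonposSchwarzian f J)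
    (hexp : 1 < |derivWithin f J e|) (hfe : f e = 0 ∨ f e = 1)
    (hd : IsC3Diffeo f (Ioo a b) (Ioo 0 1)) {η : ℝ} (hη : 0 < η) :
    ∀ᶠ δ in 𝓝[>] (0 : ℝ), ∀ x ∈ Ioo a b, min (f x) (1 - f x) < δ →
      min x (1 - x) < δ ∨ |x - c| < η := by
  obtain ⟨ρ, -, -, hρ⟩ := hs.expansion h hexp
  obtain ⟨δ₀, hδ₀, hx⟩ := hρ (1 / 2) (by norm_num)
  have hcont : ContinuousOn f (Ioo a b) := h.1.continuousOn.mono hs.Ioo_subset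
  obtain ⟨m, hm, hmin⟩ := (hs.isCompact δ₀ hδ₀ η hη).exists_forall_le'
    (f := fun x => min (f x) (1 - f x)) (a := 0)
    ((hcont.inf (continuousOn_const.sub hcont)).mono (sep_subset _ _))
    (fun x hx => lt_min (hd.mapsTo hx.1).1 (sub_pos.2 (hd.mapsTo hx.1).2))
  filter_upwards [Ioc_mem_nhdsGT hm] with δ hδ x hxU hfx
  rcases lt_or_ge |x - c| η with hc | hc
  · exact Or.inr hc
  refine Or.inl ?_
  rcases lt_or_ge |x - e| δ₀ with h0 | h0
  · obtain ⟨h1, h2, -⟩ := hx x hxU h0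
    have h3 := abs_sub_le_min hfe h2.le (hd.mapsTo hxU).1 (hd.mapsTo hxU).2
    linarith [min_le_abs_sub (x := x) hs.end_eq]
  · linarith [hmin x ⟨hxU, h0, hc⟩, hδ.2]

/-- Fix `x₀` near `e`. By the intermediate value theorem and injectivity, values between `f e` and
`f x₀` are attained only between `e` and `x₀`, where the branch expands. All other values lie beyond
`f x₀`, towards `c`, hence at a definite distance from `0` and `1`. The cases in which `f e` is not
an end point of the image are contradictory. -/
theorem IsSide.bad_end (hs : IsSide c e a b J) (hc0 : 0 < c) (hc1 : c < 1)
    (h : NonposSchwarzian f J)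
    (hexp : 1 < |derivWithin f J e|) (hfe : f e = 0 ∨ f e = 1)
    (hd : IsC3Diffeo f (Ioo a b) (Ioo 0 c) ∨ IsC3Diffeo f (Ioo a b) (Ioo c 1)) :
    ∀ᶠ δ in 𝓝[>] (0 : ℝ), ∀ x ∈ Ioo a b, min (f x) (1 - f x) < δ → min x (1 - x) < δ := by
  obtain ⟨ρ, -, -, hρ⟩ := hs.expansion h hexp
  have hm0 : 0 < min c (1 - c) := lt_min hc0 (sub_pos.2 hc1)
  have hm1 : min c (1 - c) ≤ 1 / 2 := by
    rcases le_total c (1 / 2) with h | h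
    · exact (min_le_left _ _).trans h
    · exact (min_le_right _ _).trans (by linarith)
  obtain ⟨δ₀, hδ₀, hx⟩ := hρ _ hm0
  obtain ⟨x₀, hx₀, hx₀e⟩ := hs.exists_near δ₀ hδ₀
  obtain ⟨h1, h2, -⟩ := hx x₀ hx₀ hx₀e
  have hm : 0 < min |f x₀ - f e| (min c (1 - c)) := lt_min ((abs_nonneg _).trans_lt h1) hm0
  have hinj : InjOn f (Ioo a b) := hd.elim IsC3Diffeo.injOn IsC3Diffeo.injOn
  have hfV : ∀ x ∈ Ioo a b, f x ∈ Ioo 0 c ∨ f x ∈ Ioo c 1 := fun x hx =>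
    hd.imp (fun h => h.mapsTo hx) (fun h => h.mapsTo hx)
  have hf01 : ∀ x ∈ Ioo a b, 0 < f x ∧ f x < 1 := fun x hx =>
    (hfV x hx).elim (fun h => ⟨h.1, h.2.trans hc1⟩) (fun h => ⟨hc0.trans h.1, h.2⟩)
  filter_upwards [Ioc_mem_nhdsGT hm] with δ hδ x hxU hfx
  by_cases hmem : x ∈ uIcc e x₀
  · have h0 : |x - e| < δ₀ := (abs_sub_left_of_mem_uIcc hmem).trans_lt hx₀e
    obtain ⟨h1, h2, -⟩ := hx x hxU h0
    have h3 := abs_sub_le_min hfe (h2.le.trans hm1) (hf01 x hxU).1 (hf01 x hxU).2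
    linarith [min_le_abs_sub (x := x) hs.end_eq]
  · exfalso
    have hsub : uIcc e x₀ ⊆ J :=
      hs.convex.ordConnected.uIcc_subset hs.end_mem (hs.Ioo_subset hx₀)
    have hnot : f x ∉ uIcc (f e) (f x₀) := by
      intro hfx'
      obtain ⟨z, hz, hzx⟩ := intermediate_value_uIcc (h.1.continuousOn.mono hsub) hfx'
      have hzJ := hsub hz
      rw [hs.eq_insert] at hzJ
      rcases hzJ with rfl | hzU
      · have := hf01 x hxU
        rcases hfe with h | h <;> linarith
      · exact hmem (hinj hzU hxU hzx ▸ hz)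
    have hle1 : δ ≤ |f x₀ - f e| := hδ.2.trans (min_le_left _ _)
    have hle2 : δ ≤ c := hδ.2.trans ((min_le_right _ _).trans (min_le_left _ _))
    have hle3 : δ ≤ 1 - c := hδ.2.trans ((min_le_right _ _).trans (min_le_right _ _))
    have h2c := h2.trans_le (min_le_left _ _)
    have h2c' := h2.trans_le (min_le_right _ _)
    refine hfx.not_ge ?_
    have hx01 := hf01 x₀ hx₀
    rcases hd with hd | hd
    · have h3 := hd.mapsTo hx₀
      have h4 := hd.mapsTo hxU
      rcases hfe with he | he <;> rw [he] at hnot hle1 h2c h2c'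
      · rw [uIcc_of_le hx01.1.le, mem_Icc, not_and_or, not_le, not_le] at hnot
        rw [sub_zero, abs_of_pos hx01.1] at hle1
        refine le_min ?_ (by linarith [h4.2])
        rcases hnot with h5 | h5 <;> linarith [h4.1]
      · rw [abs_of_neg (by linarith)] at h2c'
        linarith [h3.2]
    · have h3 := hd.mapsTo hx₀
      have h4 := hd.mapsTo hxU
      rcases hfe with he | he <;> rw [he] at hnot hle1 h2c h2c'
      · rw [sub_zero, abs_of_pos hx01.1] at h2c
        linarith [h3.1]
      · rw [uIcc_of_ge hx01.2.le, mem_Icc, not_and_or, not_le, not_le] at hnot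
        rw [abs_of_neg (by linarith)] at hle1
        refine le_min (by linarith [h4.1]) ?_
        rcases hnot with h5 | h5 <;> linarith [h4.2]

/-- The points that a good branch sends into `[m, 1 - m]` form a compact set missing `c`. So points
near `c` go within `m` of `0` or `1`, and these are at distance at least `2 * m` from `c`. -/
theorem IsSide.good_center (hs : IsSide c e a b J) (hc0 : 0 < c) (hc1 : c < 1)
    (hd : IsC3Diffeo f (Ioo a b) (Ioo 0 1)) :
    ∀ᶠ δ in 𝓝[>] (0 : ℝ), ∀ x ∈ Ioo a b, |x - c| < δ → δ ≤ |f x - c| := by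
  obtain ⟨k, hf, hk, hinv, -, hk3⟩ := hd
  set m := min c (1 - c) / 2 with hm
  have hm0 : 0 < m := half_pos (lt_min hc0 (sub_pos.2 hc1))
  have hmc : 2 * m ≤ c := by rw [hm]; linarith [min_le_left c (1 - c)]
  have hmc' : 2 * m ≤ 1 - c := by rw [hm]; linarith [min_le_right c (1 - c)]
  have hsub : Icc m (1 - m) ⊆ Ioo 0 1 := fun y hy => ⟨hm0.trans_le hy.1, by linarith [hy.2]⟩
  have hcl : IsClosed (k '' Icc m (1 - m)) :=
    (isCompact_Icc.image_of_continuousOn (hk3.continuousOn.mono hsub)).isClosed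
  have hc : c ∈ (k '' Icc m (1 - m))ᶜ := by
    rintro ⟨y, hy, hyc⟩
    exact hs.notMem (hyc ▸ hk (hsub hy))
  obtain ⟨δ₂, hδ₂, hball⟩ := Metric.isOpen_iff.1 hcl.isOpen_compl c hc
  filter_upwards [Ioc_mem_nhdsGT (lt_min hδ₂ hm0)] with δ hδ x hx hxc
  have h1 : x ∉ k '' Icc m (1 - m) := hball (by
    rw [Metric.mem_ball, Real.dist_eq]
    exact hxc.trans_le (hδ.2.trans (min_le_left _ _)))
  have h2 : f x ∉ Icc m (1 - m) := fun h => h1 ⟨f x, h, hinv.1 hx⟩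
  have h3 : δ ≤ m := hδ.2.trans (min_le_right _ _)
  rw [mem_Icc, not_and_or, not_le, not_le] at h2
  rcases h2 with h2 | h2
  · linarith [neg_le_abs (f x - c)]
  · linarith [le_abs_self (f x - c)]

/-- Points near `e` have values near `f e ∈ {0, 1}`, hence far from `c`. The field `min_le` of
`IsSide` accounts for the other end point of the unit interval. -/
theorem IsSide.exists_le_of_near_center (hs : IsSide c e a b J) (hc0 : 0 < c) (hc1 : c < 1)
    (h : NonposSchwarzian f J)
    (hexp : 1 < |derivWithin f J e|) (hfe : f e = 0 ∨ f e = 1) :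
    ∀ᶠ δ in 𝓝[>] (0 : ℝ), ∃ η > 0, ∀ x ∈ Ioo a b, |f x - c| < δ → η ≤ min x (1 - x) := by
  obtain ⟨ρ, -, -, hρ⟩ := hs.expansion h hexp
  have hm0 : 0 < min c (1 - c) := lt_min hc0 (sub_pos.2 hc1)
  obtain ⟨δ₀, hδ₀, hx⟩ := hρ _ (half_pos hm0)
  filter_upwards [Ioc_mem_nhdsGT (half_pos hm0)] with δ hδ
  refine ⟨min δ₀ (min c (1 - c)), lt_min hδ₀ hm0, fun x hxU hfx => ?_⟩
  refine le_trans (min_le_min_right _ ?_) (hs.min_le x hxU)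
  by_contra h0
  obtain ⟨-, h2, -⟩ := hx x hxU (not_le.1 h0)
  have h3 := abs_sub_le (f e) (f x) c
  rw [abs_sub_comm (f e) (f x)] at h3
  have h4 : min c (1 - c) ≤ |f e - c| := by
    rcases hfe with he | he
    · rw [he, zero_sub, abs_neg, abs_of_pos hc0]
      exact min_le_left _ _
    · rw [he, abs_of_pos (sub_pos.2 hc1)]
      exact min_le_right _ _
  linarith [hδ.2]

end Side

/-! ### Estimates for a whole map -/

/-- The interval `(0,1)` without `c`. -/
def punctured (c : ℝ) : Set ℝ := Ioo 0 c ∪ Ioo c 1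

theorem measurableSet_punctured (c : ℝ) : MeasurableSet (punctured c) :=
  measurableSet_Ioo.union measurableSet_Ioo

theorem forall_punctured {c : ℝ} {P : ℝ → Prop} (h1 : ∀ x ∈ Ioo 0 c, P x)
    (h2 : ∀ x ∈ Ioo c 1, P x) : ∀ x ∈ punctured c, P x :=
  fun x hx => hx.elim (h1 x) (h2 x)

/-- The properties of a good or bad map `f` of order `r` that are used in the estimates. -/
structure MapEstimates (c r : ℝ) (f : ℝ → ℝ) : Prop where
  measurable : Measurable f
  push : ∀ ρ : ℝ → ENNReal, Measurable ρ → HarnackCone 0 c ρ → HarnackCone c 1 ρ →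
    ∃ σ : ℝ → ENNReal, Measurable σ ∧ HarnackCone 0 c σ ∧ HarnackCone c 1 σ ∧
      ∀ A, MeasurableSet A →
        ∫⁻ y in A ∩ punctured c, σ y = ∫⁻ x in f ⁻¹' A ∩ punctured c, ρ x
  preimage_le : ∃ κ : ℝ, ∀ A, MeasurableSet A →
    volume (f ⁻¹' A ∩ punctured c) ≤ ENNReal.ofReal κ * volume A ^ r⁻¹
  preimage_away_le : ∀ η > 0, ∃ C : ℝ, ∀ A, MeasurableSet A →
    volume (f ⁻¹' A ∩ {x ∈ punctured c | η ≤ |x - c|}) ≤ ENNReal.ofReal C * volume A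
  -- The bound `1 / 2` is there to identify the end point `e'` near which a neighbourhood of `e` is
  -- sent.
  near_end : ∃ ρ : ℝ, 0 < ρ ∧ ρ < 1 ∧ ∀ᶠ δ in 𝓝[>] (0 : ℝ), ∀ e : ℝ, e = 0 ∨ e = 1 →
    (∃ e' : ℝ, (e' = 0 ∨ e' = 1) ∧
      ∀ x ∈ punctured c, |x - e| < δ → |f x - e'| < 1 / 2) ∧
    ∀ A, MeasurableSet A → volume (f ⁻¹' A ∩ {x ∈ punctured c | |x - e| < δ}) ≤
      ENNReal.ofReal ρ * volume A
  near_center : ∀ᶠ δ in 𝓝[>] (0 : ℝ), ∃ η > 0,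
    ∀ x ∈ punctured c, |f x - c| < δ → η ≤ min x (1 - x)

/-- The hypotheses on one branch of a good or bad map. -/
structure BranchHyp (c r e a b α β : ℝ) (J : Set ℝ) (f : ℝ → ℝ) : Prop where
  side : IsSide c e a b J
  nonpos : NonposSchwarzian f J
  expanding : 1 < |derivWithin f J e|
  end_value : f e = 0 ∨ f e = 1
  diffeo : IsC3Diffeo f (Ioo a b) (Ioo α β)
  order : ∃ K : ℝ, 0 < K ∧ ∀ x ∈ Ioo a b, K * |x - c| ^ (r - 1) ≤ |derivWithin f J x|

section Branch

variable {c r e a b α β : ℝ} {J : Set ℝ} {f : ℝ → ℝ}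

theorem BranchHyp.hasDerivAt (h : BranchHyp c r e a b α β J f) {x : ℝ} (hx : x ∈ Ioo a b) :
    HasDerivAt f (derivWithin f J x) x :=
  h.nonpos.hasDerivAt h.side.uniqueDiffOn isOpen_Ioo h.side.Ioo_subset hx

theorem BranchHyp.preimage_le (h : BranchHyp c r e a b α β J f) (hfm : Measurable f)
    (hr : 1 ≤ r) : ∃ κ : ℝ, 0 ≤ κ ∧ ∀ A, MeasurableSet A →
      volume (f ⁻¹' A ∩ Ioo a b) ≤ ENNReal.ofReal κ * volume A ^ r⁻¹ := by
  obtain ⟨K, hK, hKf⟩ := h.order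
  refine ⟨4 * (2 * K)⁻¹ ^ r⁻¹, by positivity, fun A hA => ?_⟩
  exact volume_le_rpow_of_le_abs_deriv hr hK ((hfm hA).inter measurableSet_Ioo)
    (inter_subset_right.trans (h.side.subset.trans Ioo_subset_Icc_self))
    (fun x hx => h.hasDerivAt hx.2) (h.diffeo.injOn.mono inter_subset_right)
    (fun x hx => hKf x hx.2) (fun x hx => hx.1)

theorem BranchHyp.volume_le (h : BranchHyp c r e a b α β J f) (hfm : Measurable f)
    {S : Set ℝ} (hS : MeasurableSet S) {k : ℝ} (hk : 0 < k)
    (hkS : ∀ x ∈ Ioo a b, x ∈ S → k ≤ |derivWithin f J x|) {A : Set ℝ} (hA : MeasurableSet A) :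
    volume (f ⁻¹' A ∩ (Ioo a b ∩ S)) ≤ ENNReal.ofReal k⁻¹ * volume A := by
  have h1 := volume_le_of_le_abs_deriv (A := A) (k := k)
    ((hfm hA).inter (measurableSet_Ioo.inter hS))
    (fun x hx => h.hasDerivAt hx.2.1)
    (h.diffeo.injOn.mono (inter_subset_right.trans inter_subset_left))
    (fun x hx => hkS x hx.2.1 hx.2.2) (fun x hx => hx.1)
  rw [ENNReal.ofReal_inv_of_pos hk, mul_comm, ← div_eq_mul_inv]
  rw [ENNReal.le_div_iff_mul_le (Or.inl (by simpa using hk)) (Or.inl (by simp)), mul_comm]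
  exact h1

theorem BranchHyp.preimage_away_le (h : BranchHyp c r e a b α β J f) (hfm : Measurable f)
    (hr : 1 ≤ r) {η : ℝ} (hη : 0 < η) : ∃ C : ℝ, 0 ≤ C ∧ ∀ A, MeasurableSet A →
      volume (f ⁻¹' A ∩ (Ioo a b ∩ {x | η ≤ |x - c|})) ≤ ENNReal.ofReal C * volume A := by
  obtain ⟨K, hK, hKf⟩ := h.order
  have hk : 0 < K * η ^ (r - 1) := by positivity
  refine ⟨(K * η ^ (r - 1))⁻¹, by positivity, fun A hA => h.volume_le hfm
    (measurableSet_le measurable_const (by fun_prop)) hk (fun x hx hxη => ?_) hA⟩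
  refine le_trans ?_ (hKf x hx)
  have := Real.rpow_le_rpow hη.le hxη (sub_nonneg.2 hr)
  gcongr

theorem BranchHyp.near_end (h : BranchHyp c r e a b α β J f) (hfm : Measurable f) :
    ∃ ρ : ℝ, 0 < ρ ∧ ρ < 1 ∧ ∀ᶠ δ in 𝓝[>] (0 : ℝ),
      (∀ x ∈ Ioo a b, |x - e| < δ → |f x - f e| < 1 / 2) ∧
      ∀ A, MeasurableSet A → volume (f ⁻¹' A ∩ (Ioo a b ∩ {x | |x - e| < δ})) ≤
        ENNReal.ofReal ρ * volume A := by
  obtain ⟨ρ, h0, h1, hρ⟩ := h.side.expansion h.nonpos h.expanding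
  obtain ⟨δ₀, hδ₀, hx⟩ := hρ (1 / 2) (by norm_num)
  refine ⟨ρ, h0, h1, ?_⟩
  filter_upwards [Ioc_mem_nhdsGT hδ₀] with δ hδ
  refine ⟨fun x hxU hxe => (hx x hxU (hxe.trans_le hδ.2)).2.1, fun A hA => ?_⟩
  have := h.volume_le hfm (S := {x | |x - e| < δ})
    (measurableSet_lt (by fun_prop) measurable_const) (inv_pos.2 h0)
    (fun x hxU hxe => (hx x hxU (lt_of_lt_of_le hxe hδ.2)).2.2) hA
  rwa [inv_inv] at this

end Branch

theorem HarnackCone.of_zero_or_mono {a b α β : ℝ} {σ : ℝ → ENNReal} (h : HarnackCone α β σ)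
    (hσ : ∀ y ∉ Ioo α β, σ y = 0)
    (hab : (α ≤ a ∧ b ≤ β) ∨ Disjoint (Ioo a b) (Ioo α β)) : HarnackCone a b σ := by
  rcases hab with hab | hab
  · exact h.mono hab.1 hab.2
  · exact (HarnackCone.const 0).congr fun y hy => (hσ y (hab.notMem_of_mem_left hy)).symm

/-- `(α,β)` is `(0,1)`, `(0,c)` or `(c,1)`. -/
def IsImage (c α β : ℝ) : Prop := (α = 0 ∧ β = 1) ∨ (α = 0 ∧ β = c) ∨ (α = c ∧ β = 1)

/-- A Markov property: each component of `(0,1) \ {c}` is contained in the image of a branch or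
disjoint from it, and then the density restricts or vanishes. Thus the cones on the two components
are preserved jointly. -/
theorem HarnackCone.of_isImage {c α β : ℝ} {σ : ℝ → ENNReal} (hc0 : 0 < c) (hc1 : c < 1)
    (h : HarnackCone α β σ)
    (hσ : ∀ y ∉ Ioo α β, σ y = 0) (hV : IsImage c α β) :
    HarnackCone 0 c σ ∧ HarnackCone c 1 σ := by
  have hdis : Disjoint (Ioo 0 c) (Ioo c 1) :=
    disjoint_left.2 fun x hx hx' => lt_asymm hx.2 hx'.1
  rcases hV with ⟨rfl, rfl⟩ | ⟨rfl, rfl⟩ | ⟨rfl, rfl⟩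
  · exact ⟨h.mono le_rfl hc1.le, h.mono hc0.le le_rfl⟩
  · exact ⟨h, h.of_zero_or_mono hσ (Or.inr hdis.symm)⟩
  · exact ⟨h.of_zero_or_mono hσ (Or.inr hdis), h⟩

theorem ae_mem_punctured_of_isImage {c α β : ℝ} (hV : IsImage c α β) (hc0 : 0 < c) (hc1 : c < 1) :
    ∀ᵐ y : ℝ, y ∈ Ioo α β → y ∈ punctured c := by
  have : ∀ᵐ y : ℝ, y ≠ c := Measure.ae_ne volume c
  filter_upwards [this] with y hy hyV
  have h01 : y ∈ Ioo 0 1 := by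
    rcases hV with ⟨rfl, rfl⟩ | ⟨rfl, rfl⟩ | ⟨rfl, rfl⟩
    · exact hyV
    · exact ⟨hyV.1, hyV.2.trans hc1⟩
    · exact ⟨hc0.trans hyV.1, hyV.2⟩
  rcases lt_or_gt_of_ne hy with h | h
  · exact Or.inl ⟨h01.1, h⟩
  · exact Or.inr ⟨h, h01.2⟩

theorem mapEstimates_of_branches {c r α β α' β' : ℝ} {f : ℝ → ℝ} (hc0 : 0 < c) (hc1 : c < 1)
    (hr : 1 ≤ r) (hfm : Measurable f)
    (hL : BranchHyp c r 0 0 c α β (Ico 0 c) f) (hR : BranchHyp c r 1 c 1 α' β' (Ioc c 1) f)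
    (hVL : IsImage c α β) (hVR : IsImage c α' β') : MapEstimates c r f where
  measurable := hfm
  push := fun ρ hρm hρL hρR => by
    obtain ⟨σ, hσm, hσ, hσ0, hσi⟩ := hL.nonpos.exists_push_density hL.side.uniqueDiffOn
      hL.side.Ioo_subset hL.diffeo hfm hρm hρL
    obtain ⟨σ', hσm', hσ', hσ0', hσi'⟩ := hR.nonpos.exists_push_density hR.side.uniqueDiffOn
      hR.side.Ioo_subset hR.diffeo hfm hρm hρR
    have h1 := hσ.of_isImage hc0 hc1 hσ0 hVL
    have h2 := hσ'.of_isImage hc0 hc1 hσ0' hVR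
    refine ⟨fun y => σ y + σ' y, hσm.add hσm', h1.1.add h2.1, h1.2.add h2.2, fun A hA => ?_⟩
    -- Up to the null set `{c}`, the image of a branch lies in `punctured c`, so restricting to that
    -- set loses nothing.
    have hz : ∀ {σ : ℝ → ENNReal} {α β : ℝ}, (∀ y ∉ Ioo α β, σ y = 0) → IsImage c α β →
        ∫⁻ y in A ∩ punctured c, σ y = ∫⁻ y in A, σ y := by
      intro σ α β hσ hV
      rw [inter_comm, ← setLIntegral_indicator (measurableSet_punctured c)]
      refine lintegral_congr_ae (ae_restrict_of_ae ?_)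
      filter_upwards [ae_mem_punctured_of_isImage hV hc0 hc1] with y hy
      by_cases h : y ∈ punctured c
      · rw [indicator_of_mem h]
      · rw [indicator_of_notMem h, hσ y fun h' => h (hy h')]
    rw [lintegral_add_left hσm, hz hσ0 hVL, hz hσ0' hVR, hσi A hA, hσi' A hA, punctured,
      inter_union_distrib_left, lintegral_union ((hfm hA).inter measurableSet_Ioo)]
    exact disjoint_left.2 fun x hx hx' => lt_asymm hx.2.2 hx'.2.1
  preimage_le := by
    obtain ⟨κ, hκ0, hκ⟩ := hL.preimage_le hfm hr
    obtain ⟨κ', hκ0', hκ'⟩ := hR.preimage_le hfm hr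
    refine ⟨κ + κ', fun A hA => ?_⟩
    rw [punctured, inter_union_distrib_left, ENNReal.ofReal_add hκ0 hκ0', add_mul]
    exact (measure_union_le _ _).trans (add_le_add (hκ A hA) (hκ' A hA))
  preimage_away_le := fun η hη => by
    obtain ⟨κ, hκ0, hκ⟩ := hL.preimage_away_le hfm hr hη
    obtain ⟨κ', hκ0', hκ'⟩ := hR.preimage_away_le hfm hr hη
    refine ⟨κ + κ', fun A hA => ?_⟩
    rw [show {x ∈ punctured c | η ≤ |x - c|} = punctured c ∩ {x | η ≤ |x - c|} from rfl, punctured,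
      union_inter_distrib_right, inter_union_distrib_left, ENNReal.ofReal_add hκ0 hκ0', add_mul]
    exact (measure_union_le _ _).trans (add_le_add (hκ A hA) (hκ' A hA))
  near_end := by
    obtain ⟨ρ, h0, h1, h⟩ := hL.near_end hfm
    obtain ⟨ρ', h0', h1', h'⟩ := hR.near_end hfm
    refine ⟨max ρ ρ', lt_max_of_lt_left h0, max_lt h1 h1', ?_⟩
    filter_upwards [h, h', Ioc_mem_nhdsGT (lt_min hc0 (sub_pos.2 hc1))] with δ hδ hδ' hδc e he
    rcases he with rfl | rfl
    · have hin : ∀ x ∈ punctured c, |x - 0| < δ → x ∈ Ioo 0 c := fun x hx hxδ =>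
        hx.resolve_right fun hx' => by
          rw [sub_zero, abs_of_pos (hc0.trans hx'.1)] at hxδ
          linarith [hx'.1, hδc.2, min_le_left c (1 - c)]
      refine ⟨⟨f 0, hL.end_value, fun x hx hxδ => hδ.1 x (hin x hx hxδ) hxδ⟩, fun A hA => ?_⟩
      refine (measure_mono ?_).trans ((hδ.2 A hA).trans (mul_le_mul_left
        (ENNReal.ofReal_le_ofReal (le_max_left _ _)) _))
      exact fun x hx => ⟨hx.1, hin x hx.2.1 hx.2.2, hx.2.2⟩
    · have hin : ∀ x ∈ punctured c, |x - 1| < δ → x ∈ Ioo c 1 := fun x hx hxδ =>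
        hx.resolve_left fun hx' => by
          rw [abs_of_neg (sub_neg.2 (hx'.2.trans hc1))] at hxδ
          linarith [hx'.2, hδc.2, min_le_right c (1 - c)]
      refine ⟨⟨f 1, hR.end_value, fun x hx hxδ => hδ'.1 x (hin x hx hxδ) hxδ⟩, fun A hA => ?_⟩
      refine (measure_mono ?_).trans ((hδ'.2 A hA).trans (mul_le_mul_left
        (ENNReal.ofReal_le_ofReal (le_max_right _ _)) _))
      exact fun x hx => ⟨hx.1, hin x hx.2.1 hx.2.2, hx.2.2⟩
  near_center := by
    filter_upwards [hL.side.exists_le_of_near_center hc0 hc1 hL.nonpos hL.expanding hL.end_value,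
      hR.side.exists_le_of_near_center hc0 hc1 hR.nonpos hR.expanding hR.end_value]
      with δ ⟨η, hη, h⟩ ⟨η', hη', h'⟩
    exact ⟨min η η', lt_min hη hη', forall_punctured
      (fun x hx hxc => (min_le_left _ _).trans (h x hx hxc))
      (fun x hx hxc => (min_le_right _ _).trans (h' x hx hxc))⟩

theorem measurable_toReal {T : unitInterval → unitInterval} (hT : Measurable T) :
    Measurable (toReal T) :=
  measurable_subtype_coe.comp (hT.comp continuous_projIcc.measurable)

section Maps

variable {c r : ℝ} {T : unitInterval → unitInterval}

theorem BranchConditions.branchHyp_left {f : ℝ → ℝ} (hc0 : 0 < c) (hc1 : c < 1)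
    (h : BranchConditions c r f) {α β : ℝ} (hd : IsC3Diffeo f (Ioo 0 c) (Ioo α β))
    (h0 : f 0 = 0 ∨ f 0 = 1) : BranchHyp c r 0 0 c α β (Ico 0 c) f where
  side := isSide_left hc0 hc1
  nonpos := h.schwarzian_left
  expanding := h.expanding_zero
  end_value := h0
  diffeo := hd
  order := by
    obtain ⟨K, M, hK, -, -, hL, -⟩ := h.order_bounds
    exact ⟨K, hK, fun x hx => (hL x ⟨hx.1.le, hx.2⟩).1⟩

theorem BranchConditions.branchHyp_right {f : ℝ → ℝ} (hc0 : 0 < c) (hc1 : c < 1)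
    (h : BranchConditions c r f) {α β : ℝ} (hd : IsC3Diffeo f (Ioo c 1) (Ioo α β))
    (h0 : f 1 = 0 ∨ f 1 = 1) : BranchHyp c r 1 c 1 α β (Ioc c 1) f where
  side := isSide_right hc0 hc1
  nonpos := h.schwarzian_right
  expanding := h.expanding_one
  end_value := h0
  diffeo := hd
  order := by
    obtain ⟨K, M, hK, -, -, -, hR⟩ := h.order_bounds
    exact ⟨K, hK, fun x hx => (hR x ⟨hx.1, hx.2.le⟩).1⟩

theorem IsGoodMapOfOrder.mapEstimates (hc0 : 0 < c) (hc1 : c < 1)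
    (h : IsGoodMapOfOrder c r T) : MapEstimates c r (toReal T) :=
  mapEstimates_of_branches hc0 hc1 h.one_le_order
    (measurable_toReal (h.branches.measurable hc0 hc1))
    (h.branches.branchHyp_left hc0 hc1 h.diffeo_left (h.special_points 0 (by simp)))
    (h.branches.branchHyp_right hc0 hc1 h.diffeo_right (h.special_points 1 (by simp)))
    (Or.inl ⟨rfl, rfl⟩) (Or.inl ⟨rfl, rfl⟩)

theorem IsBadMapOfOrder.mapEstimates (hc0 : 0 < c) (hc1 : c < 1)
    (h : IsBadMapOfOrder c r T) : MapEstimates c r (toReal T) := by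
  have hm := measurable_toReal (h.branches.measurable hc0 hc1)
  have h0 := h.end_points 0 (by simp)
  have h1 := h.end_points 1 (by simp)
  rcases h.diffeo_left with hl | hl <;> rcases h.diffeo_right with hr | hr <;>
    exact mapEstimates_of_branches hc0 hc1 h.one_lt_order.le hm
      (h.branches.branchHyp_left hc0 hc1 hl h0) (h.branches.branchHyp_right hc0 hc1 hr h1)
      (by simp [IsImage]) (by simp [IsImage])

theorem IsGoodMapOfOrder.eventually_center (hc0 : 0 < c) (hc1 : c < 1)
    (h : IsGoodMapOfOrder c r T) : ∀ᶠ δ in 𝓝[>] (0 : ℝ), ∀ x ∈ punctured c, |x - c| < δ →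
      δ ≤ |toReal T x - c| := by
  filter_upwards [(isSide_left hc0 hc1).good_center hc0 hc1 h.diffeo_left,
    (isSide_right hc0 hc1).good_center hc0 hc1 h.diffeo_right] with δ h1 h2
  exact forall_punctured h1 h2

theorem IsGoodMapOfOrder.eventually_end (hc0 : 0 < c) (hc1 : c < 1)
    (h : IsGoodMapOfOrder c r T) {η : ℝ} (hη : 0 < η) :
    ∀ᶠ δ in 𝓝[>] (0 : ℝ), ∀ x ∈ punctured c, min (toReal T x) (1 - toReal T x) < δ →
      min x (1 - x) < δ ∨ |x - c| < η := by
  filter_upwards [(isSide_left hc0 hc1).good_end h.branches.schwarzian_left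
      h.branches.expanding_zero (h.special_points 0 (by simp)) h.diffeo_left hη,
    (isSide_right hc0 hc1).good_end h.branches.schwarzian_right
      h.branches.expanding_one (h.special_points 1 (by simp)) h.diffeo_right hη] with δ h1 h2
  exact forall_punctured h1 h2

theorem IsBadMapOfOrder.eventually_end (hc0 : 0 < c) (hc1 : c < 1)
    (h : IsBadMapOfOrder c r T) :
    ∀ᶠ δ in 𝓝[>] (0 : ℝ), ∀ x ∈ punctured c, min (toReal T x) (1 - toReal T x) < δ →
      min x (1 - x) < δ := by
  filter_upwards [(isSide_left hc0 hc1).bad_end hc0 hc1 h.branches.schwarzian_left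
      h.branches.expanding_zero (h.end_points 0 (by simp)) h.diffeo_left,
    (isSide_right hc0 hc1).bad_end hc0 hc1 h.branches.schwarzian_right
      h.branches.expanding_one (h.end_points 1 (by simp)) h.diffeo_right] with δ h1 h2
  exact forall_punctured h1 h2

end Maps

/-! ### The random system and its densities -/

/-- The data of the random system, transported to the real line: `ν n` is the `n`-th iterate of
Lebesgue measure, `G` and `S` are the indices of the good and of the bad maps. -/
structure IntermittentSystem {N : ℕ} (c : ℝ) (f : Fin N → ℝ → ℝ) (p r ℓ : Fin N → ℝ)
    (G S : Finset (Fin N)) (ν : ℕ → Measure ℝ) : Prop where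
  c_pos : 0 < c
  c_lt_one : c < 1
  p_pos : ∀ j, 0 < p j
  p_sum : ∑ j, p j = 1
  cover : ∀ j, j ∈ G ∨ j ∈ S
  one_le_r : ∀ g ∈ G, 1 ≤ r g
  one_lt_ℓ : ∀ b ∈ S, 1 < ℓ b
  good : ∀ g ∈ G, MapEstimates c (r g) (f g)
  bad : ∀ b ∈ S, MapEstimates c (ℓ b) (f b)
  good_center : ∀ g ∈ G, ∀ᶠ δ in 𝓝[>] (0 : ℝ), ∀ x ∈ punctured c, |x - c| < δ → δ ≤ |f g x - c|
  good_end : ∀ g ∈ G, ∀ η > 0, ∀ᶠ δ in 𝓝[>] (0 : ℝ), ∀ x ∈ punctured c,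
    min (f g x) (1 - f g x) < δ → min x (1 - x) < δ ∨ |x - c| < η
  bad_end : ∀ b ∈ S, ∀ᶠ δ in 𝓝[>] (0 : ℝ), ∀ x ∈ punctured c,
    min (f b x) (1 - f b x) < δ → min x (1 - x) < δ
  zero : ν 0 = volume.restrict (Icc 0 1)
  succ : ∀ n A, MeasurableSet A → ν (n + 1) A = ∑ j, ENNReal.ofReal (p j) * ν n (f j ⁻¹' A)

namespace IntermittentSystem

variable {N : ℕ} {c : ℝ} {f : Fin N → ℝ → ℝ} {p r ℓ : Fin N → ℝ}
    {G S : Finset (Fin N)} {ν : ℕ → Measure ℝ}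

theorem exists_estimates (h : IntermittentSystem c f p r ℓ G S ν) (j : Fin N) :
    ∃ q, MapEstimates c q (f j) :=
  (h.cover j).elim (fun hj => ⟨_, h.good j hj⟩) fun hj => ⟨_, h.bad j hj⟩

theorem measurable (h : IntermittentSystem c f p r ℓ G S ν) (j : Fin N) : Measurable (f j) := by
  obtain ⟨q, hq⟩ := h.exists_estimates j
  exact hq.measurable

theorem sum_ofReal (h : IntermittentSystem c f p r ℓ G S ν) :
    ∑ j, ENNReal.ofReal (p j) = 1 := by
  rw [← ENNReal.ofReal_sum_of_nonneg fun j _ => (h.p_pos j).le, h.p_sum, ENNReal.ofReal_one]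

/-- The constant density one lies in both cones, and one step of the iteration is a positive
combination of push-forwards, each of which preserves them. -/
theorem exists_density (h : IntermittentSystem c f p r ℓ G S ν) (n : ℕ) :
    ∃ ρ : ℝ → ENNReal, Measurable ρ ∧ HarnackCone 0 c ρ ∧ HarnackCone c 1 ρ ∧
      ∀ A, MeasurableSet A → ν n A = ∫⁻ x in A ∩ punctured c, ρ x := by
  induction n with
  | zero =>
    refine ⟨fun _ => 1, measurable_const, .const 1, .const 1, fun A hA => ?_⟩
    rw [h.zero, Measure.restrict_apply hA, setLIntegral_const, one_mul]
    refine measure_congr ?_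
    filter_upwards [Measure.ae_ne volume (0 : ℝ), Measure.ae_ne volume c,
      Measure.ae_ne volume (1 : ℝ)] with x h0 hc h1
    refine propext (and_congr_right fun _ => ?_)
    have hc0 := h.c_pos
    have hc1 := h.c_lt_one
    constructor
    · rintro ⟨hx0, hx1⟩
      rcases lt_or_gt_of_ne hc with h' | h'
      · exact Or.inl ⟨lt_of_le_of_ne hx0 (Ne.symm h0), h'⟩
      · exact Or.inr ⟨h', lt_of_le_of_ne hx1 h1⟩
    · rintro (⟨h2, h3⟩ | ⟨h2, h3⟩) <;> constructor <;> linarith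
  | succ n ih =>
    obtain ⟨ρ, hρm, hρL, hρR, hρ⟩ := ih
    have hex : ∀ j, ∃ σ : ℝ → ENNReal, Measurable σ ∧ HarnackCone 0 c σ ∧ HarnackCone c 1 σ ∧
        ∀ A, MeasurableSet A →
          ∫⁻ y in A ∩ punctured c, σ y = ∫⁻ x in f j ⁻¹' A ∩ punctured c, ρ x := fun j => by
      obtain ⟨q, hq⟩ := h.exists_estimates j
      exact hq.push ρ hρm hρL hρR
    choose σ hσm hσL hσR hσ using hex
    refine ⟨fun x => ∑ j, ENNReal.ofReal (p j) * σ j x,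
      Finset.measurable_fun_sum _ fun j _ => (hσm j).const_mul _,
      .sum _ fun j _ => (hσL j).const_mul _, .sum _ fun j _ => (hσR j).const_mul _,
      fun A hA => ?_⟩
    rw [h.succ n A hA, lintegral_finsetSum _ fun j _ => (hσm j).const_mul _]
    refine Finset.sum_congr rfl fun j _ => ?_
    rw [lintegral_const_mul _ (hσm j), hσ j A hA, hρ _ (h.measurable j hA)]

theorem measure_univ_le (h : IntermittentSystem c f p r ℓ G S ν) (n : ℕ) : ν n univ ≤ 1 := by
  induction n with
  | zero => simp [h.zero]
  | succ n ih =>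
    rw [h.succ n _ MeasurableSet.univ]
    simp only [preimage_univ]
    rw [← Finset.sum_mul, h.sum_ofReal, one_mul]
    exact ih

theorem measure_inter_punctured (h : IntermittentSystem c f p r ℓ G S ν) (n : ℕ) {A : Set ℝ}
    (hA : MeasurableSet A) : ν n (A ∩ punctured c) = ν n A := by
  obtain ⟨ρ, -, -, -, hρ⟩ := h.exists_density n
  rw [hρ _ hA, hρ _ (hA.inter (measurableSet_punctured c)), inter_assoc, inter_self]

/-- The iterates of Lebesgue measure have uniformly bounded densities away from `0`, `c`, `1`. -/
theorem exists_middle_bound (h : IntermittentSystem c f p r ℓ G S ν) {η : ℝ} (hη : 0 < η) :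
    ∃ C : ℝ, ∀ n A, MeasurableSet A → (∀ x ∈ A, η ≤ min x (1 - x) ∧ η ≤ |x - c|) →
      ν n A ≤ ENNReal.ofReal C * volume A := by
  -- From `HarnackCone.le_of_lintegral_le_one`, with both distances to the ends of the component at
  -- least `η` and its length at most one.
  refine ⟨1 / (η ^ 2 * η), fun n A hA hAη => ?_⟩
  have hc0 := h.c_pos
  have hc1 := h.c_lt_one
  obtain ⟨ρ, hρm, hρL, hρR, hρ⟩ := h.exists_density n
  have hint : ∀ U : Set ℝ, MeasurableSet U → U ⊆ punctured c → ∫⁻ x in U, ρ x ≤ 1 := by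
    intro U hU hUp
    have := hρ U hU
    rw [inter_eq_left.2 hUp] at this
    rw [← this]
    exact (measure_mono (subset_univ _)).trans (h.measure_univ_le n)
  rw [hρ A hA, ← setLIntegral_const]
  refine (setLIntegral_mono' (hA.inter (measurableSet_punctured c)) ?_).trans
    (lintegral_mono_set inter_subset_left)
  rintro x ⟨hxA, hx⟩
  obtain ⟨h1, h2⟩ := hAη x hxA
  have h1' := h1.trans (min_le_right _ _)
  have h1 := h1.trans (min_le_left _ _)
  rcases hx with hx | hx
  · refine (hρL.le_of_lintegral_le_one (hint _ measurableSet_Ioo subset_union_left) hx).trans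
      (ENNReal.ofReal_le_ofReal ?_)
    rw [abs_of_neg (sub_neg.2 hx.2)] at h2
    gcongr
    · exact pow_le_one₀ (by linarith) (by linarith)
    · linarith
    · linarith
  · refine (hρR.le_of_lintegral_le_one (hint _ measurableSet_Ioo subset_union_right) hx).trans
      (ENNReal.ofReal_le_ofReal ?_)
    rw [abs_of_pos (sub_pos.2 hx.1)] at h2
    gcongr
    exact pow_le_one₀ (by linarith) (by linarith)

end IntermittentSystem

/-! ### Series over words of bad maps -/

section Series

variable {N : ℕ} {p ℓ : Fin N → ℝ} {S : Finset (Fin N)}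

theorem wordProd_cons {k : ℕ} (w : Fin N → ℝ) (x : S) (b : Fin k → S) :
    wordProd w (Fin.cons x b : Fin (k + 1) → S) = w x * wordProd w b := by
  simp [wordProd, Fin.prod_univ_succ]

theorem wordProd_pos {k : ℕ} {w : Fin N → ℝ} (hw : ∀ j ∈ S, 0 < w j) (b : Fin k → S) :
    0 < wordProd w b :=
  Finset.prod_pos fun i _ => hw _ (b i).2

theorem one_le_wordProd {k : ℕ} {w : Fin N → ℝ} (hw : ∀ j ∈ S, 1 < w j) (b : Fin k → S) :
    1 ≤ wordProd w b := by
  rw [wordProd, ← Finset.prod_const_one (s := (Finset.univ : Finset (Fin k)))]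
  exact Finset.prod_le_prod (fun _ _ => zero_le_one) fun i _ => (hw _ (b i).2).le

/-- The series `∑_k ∑_{b ∈ S^k} p_b s^(1/ℓ_b)`. -/
def wordSeries (p ℓ : Fin N → ℝ) (S : Finset (Fin N)) (s : ENNReal) : ENNReal :=
  ∑' k : ℕ, ∑ b : Fin k → S, ENNReal.ofReal (wordProd p b) * s ^ (wordProd ℓ b)⁻¹

/-- The series `∑_k ∑_{b ∈ S^k} p_b ℓ_b s^(1/(ℓ_b r))`. -/
def weightedWordSeries (p ℓ : Fin N → ℝ) (S : Finset (Fin N)) (r : ℝ) (s : ENNReal) : ENNReal :=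
  ∑' k : ℕ, ∑ b : Fin k → S, ENNReal.ofReal (wordProd p b * wordProd ℓ b) *
    s ^ ((wordProd ℓ b)⁻¹ * r⁻¹)

theorem wordSeries_mono (hℓ : ∀ b ∈ S, 1 < ℓ b) : Monotone (wordSeries p ℓ S) := by
  intro s t hst
  refine ENNReal.tsum_le_tsum fun k => Finset.sum_le_sum fun b _ => ?_
  have := one_le_wordProd hℓ b
  gcongr

/-- The empty word gives `s`; the other words are sorted by their first letter. This functional
equation reproduces one step of the iteration near `c`. -/
theorem wordSeries_eq (hp : ∀ j, 0 < p j) (s : ENNReal) :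
    wordSeries p ℓ S s =
      s + ∑ b ∈ S, ENNReal.ofReal (p b) * wordSeries p ℓ S (s ^ (ℓ b)⁻¹) := by
  rw [wordSeries, tsum_eq_zero_add' ENNReal.summable]
  congr 1
  · simp [wordProd]
  · simp only [wordSeries, ← ENNReal.tsum_mul_left]
    rw [← Summable.tsum_finsetSum fun _ _ => ENNReal.summable]
    refine tsum_congr fun k => ?_
    rw [← Finset.sum_coe_sort S, ← (Fin.consEquiv fun _ => S).sum_comp, Fintype.sum_prod_type]
    refine Finset.sum_congr rfl fun x _ => ?_
    rw [Finset.mul_sum]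
    refine Finset.sum_congr rfl fun b _ => ?_
    change ENNReal.ofReal (wordProd p (Fin.cons x b : Fin (k + 1) → S)) *
      s ^ (wordProd ℓ (Fin.cons x b : Fin (k + 1) → S))⁻¹ = _
    rw [wordProd_cons, wordProd_cons]
    rw [ENNReal.ofReal_mul (hp x).le, mul_assoc, mul_inv, ENNReal.rpow_mul]

theorem le_wordSeries (hp : ∀ j, 0 < p j) (s : ENNReal) : s ≤ wordSeries p ℓ S s := by
  rw [wordSeries_eq hp]
  exact le_self_add

/-- All exponents are at most one, so a factor `K ≥ 1` raised to them does not exceed `K`. -/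
theorem wordSeries_mul_le (hℓ : ∀ b ∈ S, 1 < ℓ b) {K : ENNReal} (hK : 1 ≤ K) (s : ENNReal) :
    wordSeries p ℓ S (K * s) ≤ K * wordSeries p ℓ S s := by
  simp only [wordSeries, ← ENNReal.tsum_mul_left, Finset.mul_sum]
  refine ENNReal.tsum_le_tsum fun k => Finset.sum_le_sum fun b _ => ?_
  have h1 := one_le_wordProd hℓ b
  rw [ENNReal.mul_rpow_of_nonneg _ _ (by positivity), mul_left_comm]
  refine mul_le_mul_left ?_ _
  exact (ENNReal.rpow_le_rpow_of_exponent_le hK (inv_le_one_of_one_le₀ h1)).trans_eq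
    (ENNReal.rpow_one K)

theorem wordSeries_le_weighted (hp : ∀ j, 0 < p j) (hℓ : ∀ b ∈ S, 1 < ℓ b) {r : ℝ} (hr : 1 ≤ r)
    {s : ENNReal} (hs : s ≤ 1) : wordSeries p ℓ S s ≤ weightedWordSeries p ℓ S r s := by
  refine ENNReal.tsum_le_tsum fun k => Finset.sum_le_sum fun b _ => ?_
  have h1 := one_le_wordProd hℓ b
  have h2 := wordProd_pos (S := S) (fun j _ => hp j) b
  refine mul_le_mul' (ENNReal.ofReal_le_ofReal (le_mul_of_one_le_right h2.le h1)) ?_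
  refine ENNReal.rpow_le_rpow_of_exponent_ge hs ?_
  exact mul_le_of_le_one_right (by positivity) (inv_le_one_of_one_le₀ hr)

/-- With $\theta=1/(lr)\le1$, Bernoulli gives $\rho^\theta\le1-\theta(1-\rho)$. The gain
$Cl\theta(1-\rho)=C(1-\rho)/r$ no longer depends on $l$, thanks to the weight, and it pays for $D$.
-/
theorem contracted_term_le {q l r ρ C D : ℝ} (hq : 0 ≤ q) (hl : 1 ≤ l) (hr : 1 ≤ r) (hρ0 : 0 < ρ)
    (hC : 0 ≤ C) (hD : 0 ≤ D) (hCD : D * r ≤ C * (1 - ρ)) (s : ENNReal) :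
    ENNReal.ofReal C * (ENNReal.ofReal (q * l) * (ENNReal.ofReal ρ * s) ^ (l⁻¹ * r⁻¹)) +
        ENNReal.ofReal D * (ENNReal.ofReal q * (s ^ r⁻¹) ^ l⁻¹) ≤
      ENNReal.ofReal C * (ENNReal.ofReal (q * l) * s ^ (l⁻¹ * r⁻¹)) := by
  have hθ0 : 0 ≤ l⁻¹ * r⁻¹ := by positivity
  have hθ1 : l⁻¹ * r⁻¹ ≤ 1 :=
    mul_le_one₀ (inv_le_one_of_one_le₀ hl) (by positivity) (inv_le_one_of_one_le₀ hr)
  have hB : ρ ^ (l⁻¹ * r⁻¹) ≤ 1 - l⁻¹ * r⁻¹ * (1 - ρ) := by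
    have := rpow_one_add_le_one_add_mul_self (s := ρ - 1) (by linarith) hθ0 hθ1
    rw [add_sub_cancel] at this
    linarith
  rw [← ENNReal.rpow_mul, mul_comm r⁻¹, ENNReal.mul_rpow_of_nonneg _ _ hθ0,
    ENNReal.ofReal_rpow_of_pos hρ0]
  simp only [← mul_assoc]
  rw [← ENNReal.ofReal_mul hC, ← ENNReal.ofReal_mul (by positivity), ← ENNReal.ofReal_mul hD,
    ← add_mul, ← ENNReal.ofReal_add (by positivity) (by positivity)]
  refine mul_le_mul_left (ENNReal.ofReal_le_ofReal ?_) _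
  have h1 : D ≤ C * l * (l⁻¹ * r⁻¹ * (1 - ρ)) := by
    have : C * l * (l⁻¹ * r⁻¹ * (1 - ρ)) = C * (1 - ρ) / r := by field_simp
    rwa [this, le_div_iff₀ (by positivity)]
  have h2 : C * l * ρ ^ (l⁻¹ * r⁻¹) ≤ C * l * (1 - l⁻¹ * r⁻¹ * (1 - ρ)) := by gcongr
  have h3 : C * l * ρ ^ (l⁻¹ * r⁻¹) + D ≤ C * l := by linarith
  calc C * (q * l) * ρ ^ (l⁻¹ * r⁻¹) + D * q = q * (C * l * ρ ^ (l⁻¹ * r⁻¹) + D) := by ring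
    _ ≤ q * (C * l) := by gcongr
    _ = C * (q * l) := by ring

/-- The weighted series absorbs one step of contraction near the end points. -/
theorem weightedWordSeries_contract (hp : ∀ j, 0 < p j) (hℓ : ∀ b ∈ S, 1 < ℓ b)
    {r ρ C D : ℝ} (hr : 1 ≤ r) (hρ0 : 0 < ρ)
    (hC : 0 ≤ C) (hD : 0 ≤ D) (hCD : D * r ≤ C * (1 - ρ)) (s : ENNReal) :
    ENNReal.ofReal C * weightedWordSeries p ℓ S r (ENNReal.ofReal ρ * s) +
        ENNReal.ofReal D * wordSeries p ℓ S (s ^ r⁻¹) ≤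
      ENNReal.ofReal C * weightedWordSeries p ℓ S r s := by
  simp only [weightedWordSeries, wordSeries, ← ENNReal.tsum_mul_left, ← ENNReal.tsum_add,
    Finset.mul_sum, ← Finset.sum_add_distrib]
  refine ENNReal.tsum_le_tsum fun k => Finset.sum_le_sum fun b _ => ?_
  exact contracted_term_le (wordProd_pos (fun j _ => hp j) b).le (one_le_wordProd hℓ b) hr hρ0
    hC hD hCD s

end Series

/-- After rescaling Lebesgue measure, the constants in the estimates for the bad maps are `1`. -/
theorem exists_rescaling {ι : Type*} (S : Finset ι) {ℓ κ : ι → ℝ} (hℓ : ∀ b ∈ S, 1 < ℓ b) :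
    ∃ t : ℝ, 0 < t ∧ t ≤ 1 ∧ ∀ b ∈ S, ∀ v : ENNReal,
      ENNReal.ofReal t * (ENNReal.ofReal (κ b) * v ^ (ℓ b)⁻¹) ≤
        (ENNReal.ofReal t * v) ^ (ℓ b)⁻¹ := by
  -- The exponent is positive because `ℓ b > 1`, so the product tends to `0` with `t`.
  have h1 : ∀ᶠ t in 𝓝[>] (0 : ℝ), ∀ b ∈ S, κ b * t ^ (1 - (ℓ b)⁻¹) < 1 := by
    refine (Finset.eventually_all S).2 fun b hb => ?_
    have hpos : 0 < 1 - (ℓ b)⁻¹ := sub_pos.2 (inv_lt_one_of_one_lt₀ (hℓ b hb))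
    have h2 : Tendsto (fun t : ℝ => κ b * t ^ (1 - (ℓ b)⁻¹)) (𝓝[>] 0)
        (𝓝 (κ b * (0 : ℝ) ^ (1 - (ℓ b)⁻¹))) :=
      ((Real.continuousAt_rpow_const 0 _ (Or.inr hpos.le)).const_mul _).tendsto.mono_left
        nhdsWithin_le_nhds
    rw [Real.zero_rpow hpos.ne', mul_zero] at h2
    exact h2.eventually_lt_const one_pos
  obtain ⟨t, ht, ht0, ht1⟩ := (h1.and (Ioc_mem_nhdsGT one_pos)).exists
  refine ⟨t, ht0, ht1, fun b hb v => ?_⟩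
  have hinv : 0 ≤ (ℓ b)⁻¹ := inv_nonneg.2 (by linarith [hℓ b hb])
  rw [ENNReal.mul_rpow_of_nonneg _ _ hinv, ← mul_assoc, ENNReal.ofReal_rpow_of_pos ht0,
    ← ENNReal.ofReal_mul ht0.le]
  refine mul_le_mul_left (ENNReal.ofReal_le_ofReal ?_) _
  have h3 : t = t ^ (1 - (ℓ b)⁻¹) * t ^ (ℓ b)⁻¹ := by
    rw [← Real.rpow_add ht0, sub_add_cancel, Real.rpow_one]
  have h4 := mul_le_mul_of_nonneg_right (ht b hb).le (Real.rpow_nonneg ht0.le (ℓ b)⁻¹)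
  calc t * κ b = κ b * (t ^ (1 - (ℓ b)⁻¹) * t ^ (ℓ b)⁻¹) := by rw [← h3, mul_comm]
    _ ≤ t ^ (ℓ b)⁻¹ := by rw [← mul_assoc]; linarith

/-! ### Inductive estimates near c and near the end points -/

namespace IntermittentSystem

variable {N : ℕ} {c : ℝ} {f : Fin N → ℝ → ℝ} {p r ℓ : Fin N → ℝ}
    {G S : Finset (Fin N)} {ν : ℕ → Measure ℝ}

theorem succ_eq (h : IntermittentSystem c f p r ℓ G S ν) (n : ℕ) {A : Set ℝ}
    (hA : MeasurableSet A) :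
    ν (n + 1) A = ∑ j, ENNReal.ofReal (p j) * ν n (f j ⁻¹' A ∩ punctured c) := by
  rw [h.succ n A hA]
  refine Finset.sum_congr rfl fun j _ => ?_
  rw [h.measure_inter_punctured n (h.measurable j hA)]

theorem zero_le_volume (h : IntermittentSystem c f p r ℓ G S ν) (A : Set ℝ) :
    ν 0 A ≤ volume A := by
  rw [h.zero]
  exact Measure.restrict_apply_le _ _

/-- The estimate near the critical point. -/
theorem exists_center_bound (h : IntermittentSystem c f p r ℓ G S ν) :
    ∃ δ > 0, ∃ C : ℝ, 0 ≤ C ∧ ∀ n A, MeasurableSet A → (∀ x ∈ A, |x - c| < δ) →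
      ν n A ≤ ENNReal.ofReal C * wordSeries p ℓ S (volume A) := by
  have h1 : ∀ᶠ δ in 𝓝[>] (0 : ℝ), ∀ g ∈ G, ∀ x ∈ punctured c, |x - c| < δ → δ ≤ |f g x - c| :=
    (Finset.eventually_all G).2 h.good_center
  have h2 : ∀ᶠ δ in 𝓝[>] (0 : ℝ), ∀ j, ∃ η > 0,
      ∀ x ∈ punctured c, |f j x - c| < δ → η ≤ min x (1 - x) :=
    eventually_all.2 fun j => by
      obtain ⟨q, hq⟩ := h.exists_estimates j
      exact hq.near_center
  obtain ⟨δ, hG, hη, hδ0⟩ := (h1.and (h2.and self_mem_nhdsWithin)).exists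
  have hδ0 : 0 < δ := hδ0
  choose η hη0 hη using hη
  obtain ⟨η₀, hη₀0, hη₀⟩ : ∃ η₀ > 0, ∀ j, η₀ ≤ η j := by
    have : ∀ᶠ x in 𝓝[>] (0 : ℝ), ∀ j, x ≤ η j :=
      eventually_all.2 fun j => by
        filter_upwards [Ioc_mem_nhdsGT (hη0 j)] with x hx
        exact hx.2
    obtain ⟨x, hx, hx0⟩ := (this.and self_mem_nhdsWithin).exists
    exact ⟨x, hx0, hx⟩
  obtain ⟨M, hM⟩ := h.exists_middle_bound (lt_min hη₀0 hδ0)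
  have haway : ∀ j, ∃ C : ℝ, ∀ A, MeasurableSet A →
      volume (f j ⁻¹' A ∩ {x ∈ punctured c | δ ≤ |x - c|}) ≤ ENNReal.ofReal C * volume A :=
    fun j => by
      obtain ⟨q, hq⟩ := h.exists_estimates j
      exact hq.preimage_away_le δ hδ0
  choose Ca hCa using haway
  have hpre : ∀ b, ∃ κ : ℝ, b ∈ S → ∀ A, MeasurableSet A →
      volume (f b ⁻¹' A ∩ punctured c) ≤ ENNReal.ofReal κ * volume A ^ (ℓ b)⁻¹ := fun b => by
    by_cases hb : b ∈ S
    · obtain ⟨κ, hκ⟩ := (h.bad b hb).preimage_le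
      exact ⟨κ, fun _ => hκ⟩
    · exact ⟨0, fun h => absurd h hb⟩
  choose κ hκ using hpre
  obtain ⟨t, ht0, ht1, ht⟩ := exists_rescaling S (κ := κ) h.one_lt_ℓ
  have hpunct := measurableSet_punctured c
  have hm1 : MeasurableSet {x : ℝ | |x - c| < δ} :=
    measurableSet_lt (by fun_prop) measurable_const
  have hm2 : MeasurableSet {x ∈ punctured c | δ ≤ |x - c|} :=
    hpunct.inter (measurableSet_le (g := fun x : ℝ => |x - c|) measurable_const (by fun_prop))
  -- The sum collects the middle contributions of one step; the `1` covers `n = 0`. Dividing by `t`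
  -- below turns `E * volume A` into `K` times the empty-word term at `t * volume A`.
  set E : ENNReal := 1 + ∑ j, ENNReal.ofReal (p j) * (ENNReal.ofReal M * ENNReal.ofReal (Ca j))
    with hE
  have hEfin : E ≠ ⊤ := by
    rw [hE]
    exact ENNReal.add_ne_top.2 ⟨ENNReal.one_ne_top, ENNReal.sum_ne_top.2 fun j _ => by finiteness⟩
  set K : ENNReal := E * (ENNReal.ofReal t)⁻¹ with hK
  have ht' : ENNReal.ofReal t ≠ 0 := by simpa using ht0
  have hKfin : K ≠ ⊤ := ENNReal.mul_ne_top hEfin (ENNReal.inv_ne_top.2 ht')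
  have hKE : ∀ v, K * (ENNReal.ofReal t * v) = E * v := fun v => by
    rw [hK, mul_assoc, ← mul_assoc _ _ v, ENNReal.inv_mul_cancel ht' ENNReal.ofReal_ne_top, one_mul]
  have hmono := wordSeries_mono (p := p) h.one_lt_ℓ
  -- With the argument rescaled by `t`, the bad terms return with the same constant `K`, so the
  -- induction closes exactly by the functional equation `wordSeries_eq`.
  have key : ∀ n A, MeasurableSet A → (∀ x ∈ A, |x - c| < δ) →
      ν n A ≤ K * wordSeries p ℓ S (ENNReal.ofReal t * volume A) := by
    intro n
    induction n with
    | zero =>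
      intro A hA _
      calc ν 0 A ≤ 1 * volume A := by rw [one_mul]; exact h.zero_le_volume A
        _ ≤ E * volume A := mul_le_mul_left (by rw [hE]; exact le_self_add) _
        _ = K * (ENNReal.ofReal t * volume A) := (hKE _).symm
        _ ≤ _ := mul_le_mul_right (le_wordSeries h.p_pos _) _
    | succ n ih =>
      intro A hA hAc
      have hmid : ∀ j, ν n (f j ⁻¹' A ∩ {x ∈ punctured c | δ ≤ |x - c|}) ≤
          ENNReal.ofReal M * ENNReal.ofReal (Ca j) * volume A := by
        intro j
        refine (hM n _ ((h.measurable j hA).inter hm2) ?_).trans ?_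
        · rintro x ⟨hxA, hxp, hxc⟩
          exact ⟨(min_le_left _ _).trans ((hη₀ j).trans (hη j x hxp (hAc _ hxA))),
            (min_le_right _ _).trans hxc⟩
        · rw [mul_assoc]
          exact mul_le_mul_right (hCa j A hA) _
      have hterm : ∀ j, ν n (f j ⁻¹' A ∩ punctured c) ≤
          ENNReal.ofReal M * ENNReal.ofReal (Ca j) * volume A + if j ∈ S then
            K * wordSeries p ℓ S ((ENNReal.ofReal t * volume A) ^ (ℓ j)⁻¹) else 0 := by
        intro j
        split_ifs with hj
        · have hsub : f j ⁻¹' A ∩ punctured c ⊆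
              (f j ⁻¹' A ∩ {x ∈ punctured c | δ ≤ |x - c|}) ∪
              (f j ⁻¹' A ∩ punctured c ∩ {x | |x - c| < δ}) := by
            rintro x ⟨hxA, hxp⟩
            rcases le_or_gt δ |x - c| with hx | hx
            · exact Or.inl ⟨hxA, hxp, hx⟩
            · exact Or.inr ⟨⟨hxA, hxp⟩, hx⟩
          refine (measure_mono hsub).trans ((measure_union_le _ _).trans
            (add_le_add (hmid j) ?_))
          refine (ih _ (((h.measurable j hA).inter hpunct).inter hm1) fun x hx => hx.2).trans ?_
          refine mul_le_mul_right (hmono ?_) _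
          refine le_trans (mul_le_mul_right ?_ _) (ht j hj _)
          exact (measure_mono inter_subset_left).trans (hκ j hj A hA)
        · rw [add_zero]
          refine (measure_mono ?_).trans (hmid j)
          rintro x ⟨hxA, hxp⟩
          refine ⟨hxA, hxp, ?_⟩
          -- A good map sends no point near `c` close to `c`, so its preimage has only a middle
          -- part.
          by_contra hx
          have hj' : j ∈ G := (h.cover j).resolve_right hj
          exact (hG j hj' x hxp (not_le.1 hx)).not_gt (hAc _ hxA)
      rw [h.succ_eq n hA]
      calc ∑ j, ENNReal.ofReal (p j) * ν n (f j ⁻¹' A ∩ punctured c)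
          ≤ ∑ j, ENNReal.ofReal (p j) * (ENNReal.ofReal M * ENNReal.ofReal (Ca j) * volume A +
              if j ∈ S then K * wordSeries p ℓ S ((ENNReal.ofReal t * volume A) ^ (ℓ j)⁻¹)
              else 0) :=
            Finset.sum_le_sum fun j _ => mul_le_mul_right (hterm j) _
        _ = (∑ j, ENNReal.ofReal (p j) * (ENNReal.ofReal M * ENNReal.ofReal (Ca j))) * volume A +
            K * ∑ b ∈ S, ENNReal.ofReal (p b) *
              wordSeries p ℓ S ((ENNReal.ofReal t * volume A) ^ (ℓ b)⁻¹) := by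
            simp only [mul_add, Finset.sum_add_distrib, mul_ite, mul_zero, Finset.sum_ite_mem,
              Finset.univ_inter, Finset.sum_mul, Finset.mul_sum, mul_assoc, mul_left_comm K]
        _ ≤ K * (ENNReal.ofReal t * volume A) + K * ∑ b ∈ S, ENNReal.ofReal (p b) *
              wordSeries p ℓ S ((ENNReal.ofReal t * volume A) ^ (ℓ b)⁻¹) := by
            rw [hKE]
            gcongr
            rw [hE]
            exact le_add_self
        _ = K * wordSeries p ℓ S (ENNReal.ofReal t * volume A) := by
            rw [wordSeries_eq h.p_pos (ENNReal.ofReal t * volume A), mul_add]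
  refine ⟨δ, hδ0, K.toReal, ENNReal.toReal_nonneg, fun n A hA hAc => ?_⟩
  rw [ENNReal.ofReal_toReal hKfin]
  refine (key n A hA hAc).trans (mul_le_mul_right (hmono ?_) _)
  exact mul_le_of_le_one_left' (ENNReal.ofReal_le_one.2 ht1)

/-- The right-hand side of the main estimate, without the constant. -/
def totalSeries (p ℓ r : Fin N → ℝ) (G S : Finset (Fin N)) (s : ENNReal) : ENNReal :=
  ∑ g ∈ G, ENNReal.ofReal (p g) * weightedWordSeries p ℓ S (r g) s

theorem exists_wordSeries_le (h : IntermittentSystem c f p r ℓ G S ν) (hG : G.Nonempty) :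
    ∃ q : ℝ, 0 ≤ q ∧ ∀ s ≤ 1, wordSeries p ℓ S s ≤ ENNReal.ofReal q * totalSeries p ℓ r G S s := by
  obtain ⟨g, hg⟩ := hG
  have hpg := h.p_pos g
  refine ⟨(p g)⁻¹, (inv_pos.2 hpg).le, fun s hs => ?_⟩
  have h1 : ENNReal.ofReal (p g) * weightedWordSeries p ℓ S (r g) s ≤ totalSeries p ℓ r G S s :=
    Finset.single_le_sum (f := fun g => ENNReal.ofReal (p g) * weightedWordSeries p ℓ S (r g) s)
      (fun _ _ => zero_le) hg
  calc wordSeries p ℓ S s ≤ weightedWordSeries p ℓ S (r g) s :=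
        wordSeries_le_weighted h.p_pos h.one_lt_ℓ (h.one_le_r g hg) hs
    _ = ENNReal.ofReal (p g)⁻¹ *
          (ENNReal.ofReal (p g) * weightedWordSeries p ℓ S (r g) s) := by
        rw [← mul_assoc, ← ENNReal.ofReal_mul (inv_pos.2 hpg).le, inv_mul_cancel₀ hpg.ne',
          ENNReal.ofReal_one, one_mul]
    _ ≤ _ := mul_le_mul_right h1 _

/-- The estimate near the end points. -/
theorem exists_end_bound (h : IntermittentSystem c f p r ℓ G S ν) (hGne : G.Nonempty) {η : ℝ}
    (hη : 0 < η)
    {CW : ℝ} (hCW0 : 0 ≤ CW) (hCW : ∀ n A, MeasurableSet A → (∀ x ∈ A, |x - c| < η) →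
      ν n A ≤ ENNReal.ofReal CW * wordSeries p ℓ S (volume A)) :
    ∃ δ > 0, ∃ C : ℝ, 0 ≤ C ∧ ∀ n A, MeasurableSet A → (∀ x ∈ A, min x (1 - x) < δ) →
      (∀ x ∈ A, x ∈ punctured c) →
      ∀ s ≤ 1, volume A ≤ s → ν n A ≤ ENNReal.ofReal C * totalSeries p ℓ r G S s := by
  have hend : ∀ j, ∃ ρ : ℝ, 0 < ρ ∧ ρ < 1 ∧ ∀ᶠ δ in 𝓝[>] (0 : ℝ), ∀ e : ℝ, e = 0 ∨ e = 1 →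
      (∃ e' : ℝ, (e' = 0 ∨ e' = 1) ∧
        ∀ x ∈ punctured c, |x - e| < δ → |f j x - e'| < 1 / 2) ∧
      ∀ A, MeasurableSet A → volume (f j ⁻¹' A ∩ {x ∈ punctured c | |x - e| < δ}) ≤
        ENNReal.ofReal ρ * volume A := fun j => by
    obtain ⟨q, hq⟩ := h.exists_estimates j
    exact hq.near_end
  choose ρ' hρ'0 hρ'1 hend using hend
  obtain ⟨ρ, hρ0, hρ1, hρ⟩ : ∃ ρ : ℝ, 0 < ρ ∧ ρ < 1 ∧ ∀ j, ρ' j ≤ ρ := by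
    have : ∀ᶠ x in 𝓝[<] (1 : ℝ), ∀ j, ρ' j ≤ x :=
      eventually_all.2 fun j => by
        filter_upwards [Ico_mem_nhdsLT (hρ'1 j)] with x hx
        exact hx.1
    obtain ⟨x, hx, hx0, hx1⟩ := (this.and (Ioo_mem_nhdsLT (zero_lt_one (α := ℝ)))).exists
    exact ⟨x, hx0, hx1, hx⟩
  obtain ⟨δ, hδE, hδG, hδS, hδ0, hδ1⟩ := ((eventually_all.2 hend).and
    (((Finset.eventually_all G).2 fun g hg => h.good_end g hg η hη).and
    (((Finset.eventually_all S).2 h.bad_end).and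
      (Ioc_mem_nhdsGT (show (0 : ℝ) < 1 / 2 by norm_num))))).exists
  have hpre : ∀ g, ∃ κ : ℝ, g ∈ G → ∀ A, MeasurableSet A →
      volume (f g ⁻¹' A ∩ punctured c) ≤ ENNReal.ofReal κ * volume A ^ (r g)⁻¹ := fun b => by
    by_cases hb : b ∈ G
    · obtain ⟨κ, hκ⟩ := (h.good b hb).preimage_le
      exact ⟨κ, fun _ => hκ⟩
    · exact ⟨0, fun h => absurd h hb⟩
  choose κ hκ using hpre
  obtain ⟨q, hq0, hq⟩ := h.exists_wordSeries_le hGne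
  -- The part near `c` of a good preimage has measure at most `κ g * (2 * s) ^ (r g)⁻¹`. The added
  -- `1` makes the factor at least one, as `wordSeries_mul_le` requires.
  set D : Fin N → ℝ := fun g => CW * (1 + |κ g| * 2) with hD
  have hD0 : ∀ g, 0 ≤ D g := fun g => by positivity
  -- The term `2 * q` covers `n = 0`; the sum ensures the hypothesis `D * r ≤ C * (1 - ρ)` of the
  -- contraction lemma for every good map.
  set C : ℝ := 2 * q + ∑ g, D g * |r g| / (1 - ρ) with hC
  have h1ρ : 0 < 1 - ρ := sub_pos.2 hρ1
  have hsum0 : 0 ≤ ∑ g, D g * |r g| / (1 - ρ) := Finset.sum_nonneg fun g _ => by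
    have := hD0 g
    positivity
  have hC0 : 0 ≤ C := by positivity
  have hCD : ∀ g ∈ G, D g * r g ≤ C * (1 - ρ) := fun g hg => by
    rw [← div_le_iff₀ h1ρ]
    have h1 : D g * |r g| / (1 - ρ) ≤ ∑ g, D g * |r g| / (1 - ρ) :=
      Finset.single_le_sum (f := fun g => D g * |r g| / (1 - ρ))
        (fun g _ => by have := hD0 g; positivity) (Finset.mem_univ g)
    rw [abs_of_pos (by linarith [h.one_le_r g hg])] at h1
    linarith
  have hpunct := measurableSet_punctured c
  have hm : ∀ e : ℝ, MeasurableSet {x : ℝ | |x - e| < δ} := fun e =>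
    measurableSet_lt (by fun_prop) measurable_const
  have hmE : MeasurableSet {x : ℝ | min x (1 - x) < δ} :=
    measurableSet_lt (by fun_prop) measurable_const
  have hmW : MeasurableSet {x : ℝ | |x - c| < η} := measurableSet_lt (by fun_prop) measurable_const
  have hmonoW := wordSeries_mono (p := p) h.one_lt_ℓ
  have hp01 : ∀ x ∈ punctured c, 0 < x ∧ x < 1 := fun x hx =>
    hx.elim (fun hx => ⟨hx.1, hx.2.trans h.c_lt_one⟩) (fun hx => ⟨h.c_pos.trans hx.1, hx.2⟩)
  have hendcases : ∀ x ∈ punctured c, min x (1 - x) < δ → |x - 0| < δ ∨ |x - 1| < δ := by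
    intro x hx hxδ
    obtain ⟨h0, h1⟩ := hp01 x hx
    rcases min_lt_iff.1 hxδ with h2 | h2
    · exact Or.inl (by rwa [sub_zero, abs_of_pos h0])
    · exact Or.inr (by rwa [abs_of_neg (sub_neg.2 h1), neg_sub])
  have hvol : ∀ A : Set ℝ, (∀ x ∈ A, min x (1 - x) < δ) → (∀ x ∈ A, x ∈ punctured c) →
      ∀ s, (∀ e : ℝ, e = 0 ∨ e = 1 → volume (A ∩ {x | |x - e| < δ}) ≤ s) → volume A ≤ 2 * s := by
    intro A hAE hAp s hs
    have hsub : A ⊆ (A ∩ {x | |x - 0| < δ}) ∪ (A ∩ {x | |x - 1| < δ}) := fun x hx =>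
      (hendcases x (hAp x hx) (hAE x hx)).imp (fun h' => ⟨hx, h'⟩) (fun h' => ⟨hx, h'⟩)
    rw [two_mul]
    exact (measure_mono hsub).trans ((measure_union_le _ _).trans
      (add_le_add (hs 0 (Or.inl rfl)) (hs 1 (Or.inr rfl))))
  have hcenter : ∀ g ∈ G, ∀ n A, MeasurableSet A → ∀ s, volume A ≤ 2 * s →
      ν n (f g ⁻¹' A ∩ punctured c ∩ {x | |x - c| < η}) ≤
        ENNReal.ofReal (D g) * wordSeries p ℓ S (s ^ (r g)⁻¹) := by
    intro g hg n A hA s hs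
    have hr := h.one_le_r g hg
    have hr0 : 0 ≤ (r g)⁻¹ := inv_nonneg.2 (by linarith)
    refine (hCW n _ (((h.measurable g hA).inter hpunct).inter hmW) fun x hx => hx.2).trans ?_
    rw [hD, ENNReal.ofReal_mul hCW0, mul_assoc]
    refine mul_le_mul_right ?_ _
    have hv : volume (f g ⁻¹' A ∩ punctured c ∩ {x | |x - c| < η}) ≤
        ENNReal.ofReal (1 + |κ g| * 2) * s ^ (r g)⁻¹ := by
      refine (measure_mono inter_subset_left).trans ((hκ g hg A hA).trans ?_)
      calc ENNReal.ofReal (κ g) * volume A ^ (r g)⁻¹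
          ≤ ENNReal.ofReal |κ g| * (2 * s) ^ (r g)⁻¹ := by
            gcongr
            exact le_abs_self _
        _ ≤ ENNReal.ofReal |κ g| * (2 * s ^ (r g)⁻¹) := by
            rw [ENNReal.mul_rpow_of_nonneg _ _ hr0]
            gcongr
            exact (ENNReal.rpow_le_rpow_of_exponent_le one_le_two
              (inv_le_one_of_one_le₀ hr)).trans_eq (ENNReal.rpow_one 2)
        _ = ENNReal.ofReal (|κ g| * 2) * s ^ (r g)⁻¹ := by
            rw [ENNReal.ofReal_mul (abs_nonneg _), mul_assoc, ENNReal.ofReal_ofNat]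
        _ ≤ _ := by
            gcongr
            linarith
    refine (hmonoW hv).trans (wordSeries_mul_le h.one_lt_ℓ ?_ _)
    rw [ENNReal.one_le_ofReal]
    linarith [mul_nonneg (abs_nonneg (κ g)) zero_le_two]
  -- The induction bounds the parts of `A` near `0` and near `1` by `s` separately. A map may send
  -- both end points to the same one, so the total measure of the preimage near the ends need not
  -- contract, whereas the measure near each end point does.
  have key : ∀ n A, MeasurableSet A → (∀ x ∈ A, min x (1 - x) < δ) →
      (∀ x ∈ A, x ∈ punctured c) → ∀ s ≤ 1,
      (∀ e : ℝ, e = 0 ∨ e = 1 → volume (A ∩ {x | |x - e| < δ}) ≤ s) →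
      ν n A ≤ ENNReal.ofReal C * totalSeries p ℓ r G S s := by
    intro n
    induction n with
    | zero =>
      intro A hA hAE hAp s hs1 hs
      calc ν 0 A ≤ volume A := h.zero_le_volume A
        _ ≤ 2 * s := hvol A hAE hAp s hs
        _ ≤ 2 * (ENNReal.ofReal q * totalSeries p ℓ r G S s) :=
            mul_le_mul_right ((le_wordSeries h.p_pos s).trans (hq s hs1)) _
        _ = ENNReal.ofReal (2 * q) * totalSeries p ℓ r G S s := by
            rw [ENNReal.ofReal_mul zero_le_two, ENNReal.ofReal_ofNat, mul_assoc]
        _ ≤ _ := by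
            gcongr
            linarith
    | succ n ih =>
      intro A hA hAE hAp s hs1 hs
      have hprem : ∀ j, MeasurableSet (f j ⁻¹' A ∩ punctured c) := fun j =>
        (h.measurable j hA).inter hpunct
      have hρs : ENNReal.ofReal ρ * s ≤ 1 :=
        (mul_le_of_le_one_left' (ENNReal.ofReal_le_one.2 hρ1.le)).trans hs1
      have hE : ∀ j, ν n (f j ⁻¹' A ∩ punctured c ∩ {x | min x (1 - x) < δ}) ≤
          ENNReal.ofReal C * totalSeries p ℓ r G S (ENNReal.ofReal ρ * s) := by
        intro j
        refine ih _ ((hprem j).inter hmE) (fun x hx => hx.2) (fun x hx => hx.1.2) _ hρs ?_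
        intro e he
        obtain ⟨⟨e', he', hfe⟩, hle⟩ := hδE j e he
        calc volume (f j ⁻¹' A ∩ punctured c ∩ {x | min x (1 - x) < δ} ∩ {x | |x - e| < δ})
            ≤ volume (f j ⁻¹' (A ∩ {x | |x - e'| < δ}) ∩ {x ∈ punctured c | |x - e| < δ}) := by
              refine measure_mono ?_
              rintro x ⟨⟨⟨hxA, hxp⟩, -⟩, hxe⟩
              refine ⟨⟨hxA, ?_⟩, hxp, hxe⟩
              have h1 := hfe x hxp hxe
              -- The point `f j x` is `δ`-close to some end point and `1 / 2`-close to `e'`; since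
              -- `δ ≤ 1 / 2`, the two coincide.
              have h2 := hendcases _ (hAp _ hxA) (hAE _ hxA)
              change |f j x - e'| < δ
              rw [abs_lt] at h1
              rcases he' with rfl | rfl <;> rcases h2 with h2 | h2
              · exact h2
              · rw [abs_lt] at h2
                linarith [h1.2, h2.1]
              · rw [abs_lt] at h2
                linarith [h1.1, h2.2]
              · exact h2
          _ ≤ ENNReal.ofReal (ρ' j) * volume (A ∩ {x | |x - e'| < δ}) :=
              hle _ (hA.inter (hm e'))
          _ ≤ ENNReal.ofReal ρ * s := by
              gcongr
              · exact hρ j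
              · exact hs e' he'
      have hterm : ∀ j, ν n (f j ⁻¹' A ∩ punctured c) ≤
          ENNReal.ofReal C * totalSeries p ℓ r G S (ENNReal.ofReal ρ * s) + if j ∈ G then
            ENNReal.ofReal (D j) * wordSeries p ℓ S (s ^ (r j)⁻¹) else 0 := by
        intro j
        split_ifs with hj
        · have hsub : f j ⁻¹' A ∩ punctured c ⊆
              (f j ⁻¹' A ∩ punctured c ∩ {x | min x (1 - x) < δ}) ∪
              (f j ⁻¹' A ∩ punctured c ∩ {x | |x - c| < η}) := fun x hx =>
            (hδG j hj x hx.2 (hAE _ hx.1)).imp (fun h' => ⟨hx, h'⟩) (fun h' => ⟨hx, h'⟩)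
          exact (measure_mono hsub).trans ((measure_union_le _ _).trans (add_le_add (hE j)
            (hcenter j hj n A hA s (hvol A hAE hAp s hs))))
        · rw [add_zero]
          have hj' : j ∈ S := (h.cover j).resolve_left hj
          have hsub : f j ⁻¹' A ∩ punctured c ⊆
              f j ⁻¹' A ∩ punctured c ∩ {x | min x (1 - x) < δ} := fun x hx =>
            ⟨hx, hδS j hj' x hx.2 (hAE _ hx.1)⟩
          exact (measure_mono hsub).trans (hE j)
      rw [h.succ_eq n hA]
      calc ∑ j, ENNReal.ofReal (p j) * ν n (f j ⁻¹' A ∩ punctured c)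
          ≤ ∑ j, ENNReal.ofReal (p j) *
              (ENNReal.ofReal C * totalSeries p ℓ r G S (ENNReal.ofReal ρ * s) + if j ∈ G then
                ENNReal.ofReal (D j) * wordSeries p ℓ S (s ^ (r j)⁻¹) else 0) :=
            Finset.sum_le_sum fun j _ => mul_le_mul_right (hterm j) _
        _ = ENNReal.ofReal C * totalSeries p ℓ r G S (ENNReal.ofReal ρ * s) +
            ∑ g ∈ G, ENNReal.ofReal (p g) *
              (ENNReal.ofReal (D g) * wordSeries p ℓ S (s ^ (r g)⁻¹)) := by
            simp only [mul_add, Finset.sum_add_distrib, mul_ite, mul_zero, Finset.sum_ite_mem,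
              Finset.univ_inter]
            rw [← Finset.sum_mul, h.sum_ofReal, one_mul]
        _ = ∑ g ∈ G, ENNReal.ofReal (p g) * (ENNReal.ofReal C *
              weightedWordSeries p ℓ S (r g) (ENNReal.ofReal ρ * s) +
              ENNReal.ofReal (D g) * wordSeries p ℓ S (s ^ (r g)⁻¹)) := by
            simp only [totalSeries, Finset.mul_sum, mul_add, Finset.sum_add_distrib]
            congr 1
            exact Finset.sum_congr rfl fun g _ => mul_left_comm _ _ _
        _ ≤ ∑ g ∈ G, ENNReal.ofReal (p g) * (ENNReal.ofReal C *
              weightedWordSeries p ℓ S (r g) s) :=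
            Finset.sum_le_sum fun g hg => mul_le_mul_right (weightedWordSeries_contract h.p_pos
              h.one_lt_ℓ (h.one_le_r g hg) hρ0 hC0 (hD0 g) (hCD g hg) s) _
        _ = ENNReal.ofReal C * totalSeries p ℓ r G S s := by
            rw [totalSeries, Finset.mul_sum]
            exact Finset.sum_congr rfl fun g _ => mul_left_comm _ _ _
  refine ⟨δ, hδ0, C, hC0, fun n A hA hAE hAp s hs1 hs => key n A hA hAE hAp s hs1 fun e _ => ?_⟩
  exact (measure_mono inter_subset_left).trans hs

theorem exists_bound (h : IntermittentSystem c f p r ℓ G S ν) (hG : G.Nonempty) :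
    ∃ C : ℝ, 0 < C ∧ ∀ n A, MeasurableSet A → volume A ≤ 1 →
      ν n A ≤ ENNReal.ofReal C * totalSeries p ℓ r G S (volume A) := by
  -- The order matters: `η` is fixed by the estimate near `c`, `δ` is chosen depending on it, and
  -- the middle region is what both neighbourhoods leave.
  obtain ⟨η, hη, CW, hCW0, hCW⟩ := h.exists_center_bound
  obtain ⟨δ, hδ, CE, hCE0, hCE⟩ := h.exists_end_bound hG hη hCW0 hCW
  obtain ⟨M, hM⟩ := h.exists_middle_bound (lt_min hδ hη)
  obtain ⟨q, hq0, hq⟩ := h.exists_wordSeries_le hG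
  refine ⟨CE + CW * q + |M| * q + 1, by positivity, fun n A hA hA1 => ?_⟩
  set B := A ∩ punctured c with hB
  have hBm : MeasurableSet B := hA.inter (measurableSet_punctured c)
  have hmE : MeasurableSet {x : ℝ | min x (1 - x) < δ} :=
    measurableSet_lt (by fun_prop) measurable_const
  have hmW : MeasurableSet {x : ℝ | |x - c| < η} := measurableSet_lt (by fun_prop) measurable_const
  have hmM : MeasurableSet {x : ℝ | δ ≤ min x (1 - x) ∧ η ≤ |x - c|} :=
    (measurableSet_le (g := fun x : ℝ => min x (1 - x)) measurable_const (by fun_prop)).inter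
      (measurableSet_le (g := fun x : ℝ => |x - c|) measurable_const (by fun_prop))
  have hsub : B ⊆ (B ∩ {x | min x (1 - x) < δ}) ∪ (B ∩ {x | |x - c| < η}) ∪
      (B ∩ {x | δ ≤ min x (1 - x) ∧ η ≤ |x - c|}) := by
    intro x hx
    by_cases h1 : min x (1 - x) < δ
    · exact Or.inl (Or.inl ⟨hx, h1⟩)
    by_cases h2 : |x - c| < η
    · exact Or.inl (Or.inr ⟨hx, h2⟩)
    · exact Or.inr ⟨hx, not_lt.1 h1, not_lt.1 h2⟩
  have hle : ∀ S : Set ℝ, volume (B ∩ S) ≤ volume A := fun S =>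
    measure_mono (inter_subset_left.trans inter_subset_left)
  have e1 := hCE n (B ∩ {x | min x (1 - x) < δ}) (hBm.inter hmE) (fun x hx => hx.2)
    (fun x hx => hx.1.2) _ hA1 (hle _)
  have e2 : ν n (B ∩ {x | |x - c| < η}) ≤
      ENNReal.ofReal (CW * q) * totalSeries p ℓ r G S (volume A) := by
    refine (hCW n _ (hBm.inter hmW) fun x hx => hx.2).trans ?_
    rw [ENNReal.ofReal_mul hCW0, mul_assoc]
    exact mul_le_mul_right ((wordSeries_mono h.one_lt_ℓ (hle _)).trans (hq _ hA1)) _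
  have e3 : ν n (B ∩ {x | δ ≤ min x (1 - x) ∧ η ≤ |x - c|}) ≤
      ENNReal.ofReal (|M| * q) * totalSeries p ℓ r G S (volume A) := by
    refine (hM n _ (hBm.inter hmM) fun x hx => ⟨(min_le_left _ _).trans hx.2.1,
      (min_le_right _ _).trans hx.2.2⟩).trans ?_
    rw [ENNReal.ofReal_mul (abs_nonneg M), mul_assoc]
    exact mul_le_mul' (ENNReal.ofReal_le_ofReal (le_abs_self M))
      ((hle _).trans ((le_wordSeries h.p_pos _).trans (hq _ hA1)))
  rw [← h.measure_inter_punctured n hA]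
  calc ν n B ≤ _ := measure_mono hsub
    _ ≤ _ := (measure_union_le _ _).trans
        (add_le_add ((measure_union_le _ _).trans (add_le_add e1 e2)) e3)
    _ = ENNReal.ofReal (CE + CW * q + |M| * q) * totalSeries p ℓ r G S (volume A) := by
        rw [ENNReal.ofReal_add (by positivity) (by positivity),
          ENNReal.ofReal_add hCE0 (by positivity), add_mul, add_mul]
    _ ≤ _ := mul_le_mul_left (ENNReal.ofReal_le_ofReal (le_add_of_nonneg_right zero_le_one)) _

end IntermittentSystem

/-! ### Transport from the unit interval to the real line -/

theorem toReal_coe (T : unitInterval → unitInterval) (x : unitInterval) :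
    toReal T x = T x := by
  simp [toReal, projIcc_val]

theorem intermittentSystem {c : ℝ} (hc0 : 0 < c) (hc1 : c < 1) {N : ℕ}
    {T : Fin N → unitInterval → unitInterval}
    (hT : ∀ j, IsGoodMap c (T j) ∨ IsBadMap c (T j)) {r ℓ : Fin N → ℝ}
    (hr : ∀ g ∈ goodIndices c T, IsGoodMapOfOrder c (r g) (T g))
    (hℓ : ∀ b ∈ badIndices c T, IsBadMapOfOrder c (ℓ b) (T b))
    {p : Fin N → ℝ} (hp : ∀ j, 0 < p j) (hp1 : ∑ j, p j = 1) :
    IntermittentSystem c (fun j => toReal (T j)) p r ℓ (goodIndices c T) (badIndices c T)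
      (fun n => (lebIter p T n).map ((↑) : unitInterval → ℝ)) := by
  have hcover : ∀ j, j ∈ goodIndices c T ∨ j ∈ badIndices c T := fun j => by
    simpa [goodIndices, badIndices] using hT j
  have hTm : ∀ j, Measurable (T j) := fun j =>
    (hcover j).elim (fun h => (hr j h).branches.measurable hc0 hc1)
      fun h => (hℓ j h).branches.measurable hc0 hc1
  refine ⟨hc0, hc1, hp, hp1, hcover, fun g hg => (hr g hg).one_le_order,
    fun b hb => (hℓ b hb).one_lt_order, fun g hg => (hr g hg).mapEstimates hc0 hc1,
    fun b hb => (hℓ b hb).mapEstimates hc0 hc1, fun g hg => (hr g hg).eventually_center hc0 hc1,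
    fun g hg η hη => (hr g hg).eventually_end hc0 hc1 hη,
    fun b hb => (hℓ b hb).eventually_end hc0 hc1, ?_, fun n A hA => ?_⟩
  · exact unitInterval.measurePreserving_coe.map_eq
  · rw [Measure.map_apply measurable_subtype_coe hA]
    simp only [lebIter, Function.iterate_succ_apply']
    rw [markovOp, Measure.finsetSum_apply]
    refine Finset.sum_congr rfl fun j _ => ?_
    have hm := measurable_toReal (hTm j)
    rw [Measure.smul_apply, smul_eq_mul, Measure.map_apply (hTm j) (measurable_subtype_coe hA),
      Measure.map_apply measurable_subtype_coe (hm hA)]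
    congr 2
    ext x
    simp [toReal_coe]

end CriticalIntermittency
end

open CriticalIntermittency in
theorem theorem4p1 (c : ℝ) (hc0 : 0 < c) (hc1 : c < 1) (N : ℕ)
    (T : Fin N → unitInterval → unitInterval)
    (hT : ∀ j, IsGoodMap c (T j) ∨ IsBadMap c (T j))
    (hG : (goodIndices c T).Nonempty) (hB : (badIndices c T).Nonempty)
    (r ℓ : Fin N → ℝ)
    (hr : ∀ g ∈ goodIndices c T, IsGoodMapOfOrder c (r g) (T g))
    (hℓ : ∀ b ∈ badIndices c T, IsBadMapOfOrder c (ℓ b) (T b))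
    (p : Fin N → ℝ) (hp : ∀ j, 0 < p j) (hp1 : ∑ j, p j = 1) :
    ∃ C : ℝ, 0 < C ∧ ∀ (n : ℕ) (A : Set unitInterval), MeasurableSet A →
      lebIter p T n A ≤ ENNReal.ofReal C *
        ∑ g ∈ goodIndices c T, ENNReal.ofReal (p g) *
          ∑' k : ℕ, ∑ b : Fin k → badIndices c T,
            ENNReal.ofReal (wordProd p b * wordProd ℓ b) *
              MeasureTheory.volume A ^ ((wordProd ℓ b)⁻¹ * (r g)⁻¹) := by
  obtain ⟨C, hC, h⟩ := (intermittentSystem hc0 hc1 hT hr hℓ hp hp1).exists_bound hG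
  refine ⟨C, hC, fun n A hA => ?_⟩
  have h1 := h n (Subtype.val '' A)
    ((MeasurableEmbedding.subtype_coe measurableSet_Icc).measurableSet_image.2 hA)
  rw [← unitInterval.volume_apply, MeasureTheory.Measure.map_apply measurable_subtype_coe
    ((MeasurableEmbedding.subtype_coe measurableSet_Icc).measurableSet_image.2 hA),
    Set.preimage_image_eq A Subtype.val_injective] at h1
  -- Measure at most one is needed because the unweighted series is compared with the weighted one,
  -- whose exponents are smaller by the factor `(r g)⁻¹`.
  exact h1 MeasureTheory.prob_le_one
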